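/- Let $G=(V,A)$ be a finite digraph with $n$ vertices and $m$ arcs (parallel arcs allowed), let $s\neq t$ be vertices of $G$, and let $d\in\mathbb N$. Let $A^{(d)}=\{B\subseteq A: |B|\le d\}$. An order-$d$ cost function is a map $q\colon A^{(d)}\to\mathbb R$, i.e. a vector $q\in\mathbb R^{A^{(d)}}$. The cost of a simple directed $s$-$t$-path $P$ (identified with its set of arcs) is $\mathrm{SPP}_d(P,q)=\sum_{B\subseteq P,\,|B|\le d} q(B)$. Call $q$ linearizable if there is $c\colon A\to\mathbb R$ with $\mathrm{SPP}_d(P,q)=\sum_{a\in P}c(a)$ for every simple directed $s$-$t$-path $P$. The digraph $G$ is called $\mathcal P_{st}$-covered if every arc of $G$ lies on at least one simple directed $s$-$t$-path. Theorem. For every constant $d\in\mathbb N$ there are an algorithm and a polynomial $T$ (both depending only on $d$) such that the following holds for every acyclic, $\mathcal P_{st}$-covered digraph $G$ with source $s$ and sink $t\ne s$. The linearizable order-$d$ cost functions form a linear subspace $\mathcal L_d$ of $\mathbb R^{A^{(d)}}$. Given $(G,s,t)$, the algorithm halts after at most $T(n+m)$ steps and outputs a listing of $A^{(d)}$ together with,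 with respect to this listing, an integer matrix $M$ with $\ker M=\mathcal L_d$, whose numbers of rows and columns are at most $T(n+m)$, and a basis of $\mathcal L_d$ consisting of integer vectors. Here an algorithm is a program for a random access machine on integers with indirect addressing, in which each addition, subtraction, comparison, memory access, test and output of a number counts as one step, and which has no multiplication instruction (so that the step count is polynomially related to the running time of a Turing machine). -/

import Mathlib

/-! ## Digraphs, paths and order-`d` costs -/

/-- A finite digraph with vertices `0, …, n-1` and arcs `0, …, m-1`; the arc `a` goes from
`tail a` to `head a`. Parallel arcs are allowed. -/
structure ArcDigraph (n m : ℕ) where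
  tail : Fin m → Fin n
  head : Fin m → Fin n

/-- The sets of at most `d` arcs, `A^{(d)} = {B ⊆ A : |B| ≤ d}`. -/
abbrev ArcSubset (m d : ℕ) : Type := {B : Finset (Fin m) // B.card ≤ d}

/-- Order-`d` cost functions `q : {B ⊆ A : |B| ≤ d} → ℝ`, as vectors of `ℝ^{A^{(d)}}`. -/
abbrev OrderCost (m d : ℕ) : Type := ArcSubset m d → ℝ

namespace ArcDigraph

variable {n m : ℕ}

/-- `G.IsWalk u v p`: the sequence of arcs `p` is a directed walk from `u` to `v`. -/
def IsWalk (G : ArcDigraph n m) : Fin n → Fin n → List (Fin m) → Prop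
  | u, v, [] => u = v
  | u, v, a :: p => G.tail a = u ∧ IsWalk G (G.head a) v p

/-- `G.IsPath u v p`: the sequence of arcs `p` is a simple directed path from `u` to `v`, that is,
a walk that visits no vertex twice. -/
def IsPath (G : ArcDigraph n m) (u v : Fin n) (p : List (Fin m)) : Prop :=
  G.IsWalk u v p ∧ (u :: p.map G.head).Nodup

/-- There is no directed cycle. -/
def Acyclic (G : ArcDigraph n m) : Prop :=
  ∀ (v : Fin n) (p : List (Fin m)), G.IsWalk v v p → p = []

/-- Every arc lies on at least one simple `s`-`t`-path. -/
def PathCovered (G : ArcDigraph n m) (s t : Fin n) : Prop :=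
  ∀ a : Fin m, ∃ p : List (Fin m), G.IsPath s t p ∧ a ∈ p

/-- The cost `SPP(P, c)`, the sum of the costs `c a` of the arcs `a` of the path `P = p`. -/
def linearCost (c : Fin m → ℝ) (p : List (Fin m)) : ℝ :=
  ∑ a ∈ p.toFinset, c a

/-- The cost `SPP_d(P, q)`, the sum of the interaction costs `q B` over all sets `B` of at most `d`
arcs of the path `P = p`. -/
def orderCost {d : ℕ} (q : OrderCost m d) (p : List (Fin m)) : ℝ :=
  ∑ B : ArcSubset m d with B.1 ⊆ p.toFinset, q B

/-- The instance `(G, s, t, q)` of the order-`d` shortest path problem is linearizable. -/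
def Linearizable (G : ArcDigraph n m) (s t : Fin n) {d : ℕ} (q : OrderCost m d) : Prop :=
  ∃ c : Fin m → ℝ, ∀ p : List (Fin m), G.IsPath s t p → orderCost q p = linearCost c p

/-- The input word: `n, m, s, t`, then the tails of all arcs, then the heads of all arcs. -/
def inputWord (G : ArcDigraph n m) (s t : Fin n) : List ℤ :=
  [(n : ℤ), (m : ℤ), ((s : ℕ) : ℤ), ((t : ℕ) : ℤ)]
    ++ List.ofFn (fun a => ((G.tail a : ℕ) : ℤ)) ++ List.ofFn (fun a => ((G.head a : ℕ) : ℤ))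

end ArcDigraph

/-! ## The machine model

Structured programs for a random access machine. The memory consists of arrays of integer cells,
of which a program can name only finitely many; cell addresses can be computed (indirect
addressing). Every elementary operation (constant, memory read, addition, subtraction, comparison,
assignment, test, output) takes one step. There is no multiplication, so that the bit length of the
largest number in use (constants of the program included) grows by at most one with each step, and
the step count is polynomially related to the running time of a Turing machine. -/

namespace RAM

/-- Integer expressions; `read a i` is the content of cell `i` of the array named `a`. -/
inductive Expr : Type
  | const (k : ℤ) : Expr
  | read (a : ℕ) (i : Expr) : Expr
  | add (x y : Expr) : Expr
  | sub (x y : Expr) : Expr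
  | lt (x y : Expr) : Expr
  | eq (x y : Expr) : Expr

/-- Programs. -/
inductive Prog : Type
  | skip : Prog
  | write (a : ℕ) (i x : Expr) : Prog
  | emit (x : Expr) : Prog
  | seq (p q : Prog) : Prog
  | ite (x : Expr) (p q : Prog) : Prog
  | while (x : Expr) (p : Prog) : Prog

/-- A state of the machine: the memory (array name, cell address, content) and the word that has
been output so far. -/
structure State : Type where
  mem : ℕ → ℤ → ℤ
  out : List ℤ

/-- The value of an expression; comparisons yield `1` for true and `0` for false. -/
def Expr.eval (μ : ℕ → ℤ → ℤ) : Expr → ℤ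
  | .const k => k
  | .read a i => μ a (i.eval μ)
  | .add x y => x.eval μ + y.eval μ
  | .sub x y => x.eval μ - y.eval μ
  | .lt x y => if x.eval μ < y.eval μ then 1 else 0
  | .eq x y => if x.eval μ = y.eval μ then 1 else 0

/-- The number of steps of an evaluation, one for each operation. -/
def Expr.cost : Expr → ℕ
  | .const _ => 1
  | .read _ i => i.cost + 1
  | .add x y => x.cost + y.cost + 1
  | .sub x y => x.cost + y.cost + 1
  | .lt x y => x.cost + y.cost + 1
  | .eq x y => x.cost + y.cost + 1

/-- Write `v` to cell `i` of array `a`. -/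
def State.write (σ : State) (a : ℕ) (i v : ℤ) : State :=
  { σ with mem := Function.update σ.mem a (Function.update (σ.mem a) i v) }

/-- Append `v` to the output. -/
def State.emit (σ : State) (v : ℤ) : State :=
  { σ with out := σ.out ++ [v] }

/-- `Exec p σ k τ`: started in the state `σ`, the program `p` halts after exactly `k` steps in the
state `τ`. -/
inductive Exec : Prog → State → ℕ → State → Prop
  | skip (σ : State) : Exec .skip σ 1 σ
  | write (σ : State) (a : ℕ) (i x : Expr) :
      Exec (.write a i x) σ (i.cost + x.cost + 1) (σ.write a (i.eval σ.mem) (x.eval σ.mem))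
  | emit (σ : State) (x : Expr) :
      Exec (.emit x) σ (x.cost + 1) (σ.emit (x.eval σ.mem))
  | seq {p q : Prog} {σ τ υ : State} {k l : ℕ} :
      Exec p σ k τ → Exec q τ l υ → Exec (.seq p q) σ (k + l) υ
  | ite_true {x : Expr} {p q : Prog} {σ τ : State} {k : ℕ} :
      x.eval σ.mem ≠ 0 → Exec p σ k τ → Exec (.ite x p q) σ (x.cost + 1 + k) τ
  | ite_false {x : Expr} {p q : Prog} {σ τ : State} {k : ℕ} :
      x.eval σ.mem = 0 → Exec q σ k τ → Exec (.ite x p q) σ (x.cost + 1 + k) τ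
  | while_true {x : Expr} {p : Prog} {σ τ υ : State} {k l : ℕ} :
      x.eval σ.mem ≠ 0 → Exec p σ k τ → Exec (.while x p) τ l υ →
      Exec (.while x p) σ (x.cost + 1 + k + l) υ
  | while_false {x : Expr} {p : Prog} {σ : State} :
      x.eval σ.mem = 0 → Exec (.while x p) σ (x.cost + 1) σ

/-- The initial state for the input word `w`: cell `i` of array `0` holds the entry `w i`, all
other cells hold `0`, and nothing has been output. -/
def initial (w : List ℤ) : State where
  mem a i := if a = 0 ∧ 0 ≤ i then w.getD i.toNat 0 else 0
  out := []

/-- A matrix as a word: the number of rows, the number of columns, and the entries row by row. -/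
def matrixWord {r c : ℕ} (X : Matrix (Fin r) (Fin c) ℤ) : List ℤ :=
  [(r : ℤ), (c : ℤ)] ++ (List.ofFn fun i => List.ofFn (X i)).flatten

end RAM

/-- The listing of `A^{(d)}` in the order `e`, as a 0/1-matrix whose `i`-th row is the
characteristic vector of the set `e i`. -/
def ArcSubset.listing {m d N : ℕ} (e : Fin N ≃ ArcSubset m d) : Matrix (Fin N) (Fin m) ℤ :=
  fun i a => if a ∈ (e i).1 then 1 else 0

/-!
In an acyclic digraph fix canonical paths: the canonical path from `u` to `t` always continues with
the smallest arc whose head still reaches `t`. A path leaves the canonical one along a list of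
deviating arcs, and its cost telescopes into alternating sums of the costs of paths, the mixed
differences along the sublists of that list. Hence `q` is linearizable if and only if its mixed
differences along two or more arcs vanish; those along more than `d` arcs vanish for every `q` of
order `d`, which leaves polynomially many equations. In the equation of a list `C` of arcs, the
coefficient of the set of arcs of `C` is `1`, and those of the sets of arcs of the other lists are
`0`. So the matrix of the system contains an identity matrix, and a basis of its kernel can be read
off without division.

To the machine, sets and lists of at most `d` arcs are the numbers below `(n + m + 2) ^ d`, which
nested loops run through.
-/

theorem ker_mulVecLin_submatrix {κ κ' β R : Type*} [Fintype β] [CommRing R]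
    (M : Matrix κ β R) (f : κ' ≃ κ) :
    LinearMap.ker (M.submatrix f id).mulVecLin = LinearMap.ker M.mulVecLin := by
  ext x
  simp [funext_iff, f.surjective.forall, Matrix.mulVec]

section PivotBasis

variable {κ β R : Type*} [Fintype κ] [DecidableEq β] [CommRing R] {M : Matrix κ β R} {p : κ → β}

/-- If the columns `p` of `M` form the identity matrix, this is the projection to the kernel of `M`
along the span of the coordinates `p`; its columns other than the columns `p` form a basis of the
kernel. -/
def pivotProj (M : Matrix κ β R) (p : κ → β) : Matrix β β R :=
  1 - (1 : Matrix β β R).submatrix id p * M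

theorem pivotProj_apply (M : Matrix κ β R) (p : κ → β) (B C : β) :
    pivotProj M p B C = (if B = C then 1 else 0) - ∑ i, if B = p i then M i C else 0 := by
  simp [pivotProj, Matrix.mul_apply, Matrix.one_apply]

theorem pivotProj_map {R' : Type*} [CommRing R'] (f : R →+* R') (M : Matrix κ β R) (p : κ → β) :
    pivotProj (M.map f) p = (pivotProj M p).map f := by
  ext B C
  simp [pivotProj_apply, apply_ite f]

theorem mul_pivotProj [Fintype β] [DecidableEq κ] (hp : M.submatrix id p = 1) :
    M * pivotProj M p = 0 := by
  have hpivot : M * (1 : Matrix β β R).submatrix id p = 1 := by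
    rw [← hp]
    ext i j
    simp [Matrix.mul_apply, Matrix.one_apply]
  rw [pivotProj, Matrix.mul_sub, Matrix.mul_one, ← Matrix.mul_assoc, hpivot, Matrix.one_mul,
    sub_self]

theorem pivotProj_submatrix_pivot [DecidableEq κ] (hp : M.submatrix id p = 1) :
    (pivotProj M p).submatrix id p = 0 := by
  have hmul : ((1 : Matrix β β R).submatrix id p * M).submatrix id p =
      (1 : Matrix β β R).submatrix id p * M.submatrix id p := rfl
  rw [hp, Matrix.mul_one] at hmul
  simp only [pivotProj, Matrix.submatrix_sub, Pi.sub_apply, hmul, sub_self]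

theorem pivotProj_apply_of_notMem_range {B : β} (hB : B ∉ Set.range p) (C : β) :
    pivotProj M p B C = if B = C then 1 else 0 := by
  have hne : ∀ i, B ≠ p i := fun i h => hB ⟨i, h.symm⟩
  simp [pivotProj_apply, hne]

theorem exists_basis_ker_mulVecLin [Fintype β] [DecidableEq κ] (hp : M.submatrix id p = 1) :
    ∃ b : Module.Basis {C // C ∉ Set.range p} R (LinearMap.ker M.mulVecLin),
      ∀ C B, (b C : β → R) B = pivotProj M p B C := by
  classical
  have hker : ∀ C, (pivotProj M p).col C ∈ LinearMap.ker M.mulVecLin := fun C =>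
    funext fun i => congrFun₂ (mul_pivotProj hp) i C
  let v (C : {C // C ∉ Set.range p}) : LinearMap.ker M.mulVecLin := ⟨_, hker C⟩
  have hsum : ∀ (g : {C // C ∉ Set.range p} → R) B,
      (∑ C, g C • v C : LinearMap.ker M.mulVecLin).1 B = ∑ C, g C * pivotProj M p B C := by
    intro g B
    simp [v]
  have hli : LinearIndependent R v := by
    refine Fintype.linearIndependent_iff.2 fun g hg C => ?_
    have hC := hsum g C
    simpa [hg, pivotProj_apply_of_notMem_range C.2, Subtype.val_inj] using hC.symm
  refine ⟨Module.Basis.mk hli fun x _ => ?_, fun C B => by simp [v]⟩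
  suffices hx : x = ∑ C : {C // C ∉ Set.range p}, x.1 C • v C from
    hx ▸ Submodule.sum_mem _ fun C _ => Submodule.smul_mem _ _ (Submodule.subset_span ⟨C, rfl⟩)
  have hfix : (pivotProj M p).mulVec x.1 = x.1 := by
    have hMx : M.mulVec x.1 = 0 := x.2
    rw [pivotProj, Matrix.sub_mulVec, Matrix.one_mulVec, ← Matrix.mulVec_mulVec, hMx,
      Matrix.mulVec_zero, sub_zero]
  ext B
  rw [hsum, ← congrFun hfix B, Matrix.mulVec, dotProduct]
  refine Finset.sum_congr_set {C | C ∉ Set.range p} (fun C => pivotProj M p B C * x.1 C)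
    (fun C => x.1 C * pivotProj M p B C) (fun C _ => mul_comm _ _) fun C hC => ?_
  obtain ⟨j, rfl⟩ := not_not.1 hC
  rw [show pivotProj M p B (p j) = 0 from congrFun₂ (pivotProj_submatrix_pivot hp) B j, zero_mul]

end PivotBasis

namespace ArcDigraph

section CanonicalPaths

variable {n m : ℕ} {G : ArcDigraph n m} {E : Fin m → Prop} {u v w : Fin n} {a b : Fin m}
  {p q : List (Fin m)}

/-- There is a walk from `u` to `v` which uses only arcs with the property `E`. -/
def ReachVia (G : ArcDigraph n m) (E : Fin m → Prop) (u v : Fin n) : Prop :=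
  ∃ p, G.IsWalk u v p ∧ ∀ a ∈ p, E a

/-- There is a walk from `u` to `v`. -/
def Reach (G : ArcDigraph n m) (u v : Fin n) : Prop :=
  ∃ p, G.IsWalk u v p

theorem reachVia_true : G.ReachVia (fun _ => True) u v ↔ G.Reach u v := by
  simp [ReachVia, Reach]

theorem isWalk_append : G.IsWalk u w (p ++ q) ↔ ∃ v, G.IsWalk u v p ∧ G.IsWalk v w q := by
  induction p generalizing u with
  | nil => simp [IsWalk]
  | cons a p ih => simp [IsWalk, ih, and_assoc]

theorem Reach.refl (u : Fin n) : G.Reach u u := ⟨[], rfl⟩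

theorem Reach.trans (h : G.Reach u v) (h' : G.Reach v w) : G.Reach u w := by
  obtain ⟨p, hp⟩ := h
  obtain ⟨q, hq⟩ := h'
  exact ⟨p ++ q, isWalk_append.2 ⟨v, hp, hq⟩⟩

theorem reach_tail_head (a : Fin m) : G.Reach (G.tail a) (G.head a) := ⟨[a], rfl, rfl⟩

theorem Reach.tail_of_head (h : G.Reach (G.head a) w) : G.Reach (G.tail a) w :=
  (reach_tail_head a).trans h

theorem Reach.exists_arc (h : G.Reach u w) (huw : u ≠ w) :
    ∃ a, G.tail a = u ∧ G.Reach (G.head a) w := by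
  obtain ⟨_ | ⟨a, p⟩, hp⟩ := h
  · exact absurd hp huw
  · exact ⟨a, hp.1, p, hp.2⟩

theorem IsWalk.reach_tail_of_mem (h : G.IsWalk u v p) (ha : a ∈ p) : G.Reach u (G.tail a) := by
  obtain ⟨q, r, rfl⟩ := List.append_of_mem ha
  obtain ⟨x, hq, rfl, -⟩ := isWalk_append.1 h
  exact ⟨q, hq⟩

theorem IsWalk.head_reach_of_mem (h : G.IsWalk u v p) (ha : a ∈ p) : G.Reach (G.head a) v := by
  obtain ⟨q, r, rfl⟩ := List.append_of_mem ha
  obtain ⟨x, -, -, hr⟩ := isWalk_append.1 h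
  exact ⟨r, hr⟩

namespace Acyclic

theorem not_reach (hG : G.Acyclic) (a : Fin m) : ¬ G.Reach (G.head a) (G.tail a) := by
  rintro ⟨p, hp⟩
  exact List.cons_ne_nil a p (hG (G.tail a) (a :: p) ⟨rfl, hp⟩)

theorem isPath_iff (hG : G.Acyclic) : G.IsPath u v p ↔ G.IsWalk u v p := by
  refine ⟨And.left, fun h => ⟨h, ?_⟩⟩
  induction p generalizing u with
  | nil => simp
  | cons a p ih =>
    refine List.nodup_cons.2 ⟨fun hu => ?_, ih h.2⟩
    obtain ⟨b, hb, rfl⟩ := List.mem_map.1 hu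
    exact hG.not_reach b (h.reach_tail_of_mem hb)

theorem nodup (hG : G.Acyclic) (h : G.IsWalk u v p) : p.Nodup :=
  (List.nodup_cons.1 (hG.isPath_iff.2 h).2).2.of_map

theorem length_lt (hG : G.Acyclic) (h : G.IsWalk u v p) : p.length < n := by
  simpa [Nat.succ_le_iff] using (hG.isPath_iff.2 h).2.length_le_card

theorem wellFounded (hG : G.Acyclic) :
    WellFounded fun v u => ∃ a, G.tail a = u ∧ G.Reach (G.head a) v := by
  let r (v u : Fin n) : Prop := ∃ a, G.tail a = u ∧ G.Reach (G.head a) v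
  have : Std.Irrefl r := ⟨by rintro _ ⟨a, rfl, ha⟩; exact hG.not_reach a ha⟩
  have : IsTrans (Fin n) r := ⟨by
    rintro w _ _ ⟨b, rfl, hb⟩ ⟨a, rfl, ha⟩
    exact ⟨a, rfl, ha.trans hb.tail_of_head⟩⟩
  exact Finite.wellFounded_of_trans_of_irrefl r

end Acyclic

/-- The arc `a` is the canonical arc by which to proceed from its tail towards `w`: the first arc
leaving `tail a` from which `w` can be reached. -/
def IsCanonArc (G : ArcDigraph n m) (w : Fin n) (a : Fin m) : Prop :=
  G.Reach (G.head a) w ∧ ∀ b < a, G.tail b = G.tail a → ¬ G.Reach (G.head b) w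

theorem IsCanonArc.eq (ha : G.IsCanonArc w a) (hb : G.IsCanonArc w b)
    (h : G.tail a = G.tail b) : a = b := by
  rcases lt_trichotomy a b with hab | hab | hab
  · exact absurd ha.1 (hb.2 a hab h)
  · exact hab
  · exact absurd hb.1 (ha.2 b hab h.symm)

theorem exists_isCanonArc (h : G.Reach u w) (huw : u ≠ w) :
    ∃ a, G.tail a = u ∧ G.IsCanonArc w a := by
  obtain ⟨a, ⟨rfl, ha⟩, hmin⟩ := wellFounded_lt.has_min
    {a | G.tail a = u ∧ G.Reach (G.head a) w} (h.exists_arc huw)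
  exact ⟨a, rfl, ha, fun b hb hba hbw => hmin b ⟨hba, hbw⟩ hb⟩

theorem Acyclic.exists_canonical_walk (hG : G.Acyclic) (h : G.Reach u w) :
    ∃ p, G.IsWalk u w p ∧ ∀ a ∈ p, G.IsCanonArc w a := by
  induction u using hG.wellFounded.induction with
  | _ u ih =>
    rcases eq_or_ne u w with rfl | huw
    · exact ⟨[], rfl, by simp⟩
    · obtain ⟨a, rfl, ha⟩ := exists_isCanonArc h huw
      obtain ⟨p, hp, hcanon⟩ := ih (G.head a) ⟨a, rfl, Reach.refl _⟩ ha.1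
      exact ⟨a :: p, ⟨rfl, hp⟩, List.forall_mem_cons.2 ⟨ha, hcanon⟩⟩

theorem Acyclic.canonical_walk_unique (hG : G.Acyclic) (hp : G.IsWalk u w p)
    (hpc : ∀ a ∈ p, G.IsCanonArc w a) (hq : G.IsWalk u w q) (hqc : ∀ a ∈ q, G.IsCanonArc w a) :
    p = q := by
  induction p generalizing u q with
  | nil =>
    obtain rfl : u = w := hp
    exact (hG u q hq).symm
  | cons a p ih =>
    obtain ⟨rfl, hp⟩ := hp
    cases q with
    | nil =>
      obtain rfl : G.tail a = w := hq
      exact absurd ⟨p, hp⟩ (hG.not_reach a)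
    | cons b q =>
      obtain ⟨hba, hq⟩ := hq
      obtain rfl := (hqc b List.mem_cons_self).eq (hpc a List.mem_cons_self) hba
      rw [ih hp (List.forall_mem_cons.1 hpc).2 hq (List.forall_mem_cons.1 hqc).2]

open Classical in
/-- The canonical path from `u` to `w`, which consists of canonical arcs; it is the empty list if
`w` cannot be reached from `u`. -/
noncomputable def canonPath (G : ArcDigraph n m) (u w : Fin n) : List (Fin m) :=
  if h : ∃ p, G.IsWalk u w p ∧ ∀ a ∈ p, G.IsCanonArc w a then h.choose else []

theorem isCanonArc_of_mem_canonPath (h : a ∈ G.canonPath u w) : G.IsCanonArc w a := by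
  rw [canonPath] at h
  split_ifs at h with hex
  · exact hex.choose_spec.2 a h
  · exact absurd h List.not_mem_nil

namespace Acyclic

theorem isWalk_canonPath (hG : G.Acyclic) (h : G.Reach u w) :
    G.IsWalk u w (G.canonPath u w) := by
  have hex := hG.exists_canonical_walk h
  rw [canonPath, dif_pos hex]
  exact hex.choose_spec.1

theorem canonPath_eq (hG : G.Acyclic) (hp : G.IsWalk u w p) (hpc : ∀ a ∈ p, G.IsCanonArc w a) :
    G.canonPath u w = p :=
  hG.canonical_walk_unique (hG.isWalk_canonPath ⟨p, hp⟩)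
    (fun _ => isCanonArc_of_mem_canonPath) hp hpc

theorem canonPath_self (hG : G.Acyclic) (w : Fin n) : G.canonPath w w = [] :=
  hG.canonPath_eq rfl (by simp)

theorem canonPath_tail (hG : G.Acyclic) (ha : G.IsCanonArc w a) :
    G.canonPath (G.tail a) w = a :: G.canonPath (G.head a) w :=
  hG.canonPath_eq ⟨rfl, hG.isWalk_canonPath ha.1⟩
    (List.forall_mem_cons.2 ⟨ha, fun _ => isCanonArc_of_mem_canonPath⟩)

theorem mem_canonPath (hG : G.Acyclic) (h : G.Reach u w) :
    a ∈ G.canonPath u w ↔ G.IsCanonArc w a ∧ G.ReachVia (G.IsCanonArc w) u (G.tail a) := by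
  constructor
  · intro ha
    refine ⟨isCanonArc_of_mem_canonPath ha, ?_⟩
    have hwalk := hG.isWalk_canonPath h
    have hcanon : ∀ b ∈ G.canonPath u w, G.IsCanonArc w b := fun _ => isCanonArc_of_mem_canonPath
    obtain ⟨q, r, hqr⟩ := List.append_of_mem ha
    rw [hqr] at hwalk hcanon
    obtain ⟨_, hq, rfl, -⟩ := isWalk_append.1 hwalk
    exact ⟨q, hq, fun b hb => hcanon b (List.mem_append_left _ hb)⟩
  · rintro ⟨ha, q, hq, hqc⟩
    rw [hG.canonPath_eq (p := q ++ G.canonPath (G.tail a) w)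
      (isWalk_append.2 ⟨_, hq, hG.isWalk_canonPath ha.1.tail_of_head⟩), hG.canonPath_tail ha]
    · simp
    · exact List.forall_mem_append.2 ⟨hqc, fun _ => isCanonArc_of_mem_canonPath⟩

end Acyclic

end CanonicalPaths

section MixedDifferences

variable {n m : ℕ} {G : ArcDigraph n m} {s u v w t : Fin n} {a c x : Fin m} {C D P Q : List (Fin m)}
  {B : Finset (Fin m)} {A : Type*} [AddCommGroup A]

/-- `D` lists, starting with the last one, arcs at which a walk from `s` to `w` can deviate from
canonical paths: the last arc of `D` that is used is followed by the canonical path to `w`, and the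
remaining arcs of `D` describe in the same way a walk from `s` to the tail of that arc. -/
def IsDeviation (G : ArcDigraph n m) (s : Fin n) : List (Fin m) → Fin n → Prop
  | [], w => G.Reach s w
  | a :: D, w => G.Reach (G.head a) w ∧ ¬ G.IsCanonArc w a ∧ IsDeviation G s D (G.tail a)

/-- The mixed difference of a function `F` of walks from `s` to `w` along the deviation `D`: each
arc `a` of `D` contributes the difference between going via `a` and going canonically. -/
noncomputable def mixedDiff (G : ArcDigraph n m) (s : Fin n) :
    List (Fin m) → Fin n → (List (Fin m) → A) → A
  | [], w, F => F (G.canonPath s w)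
  | a :: D, w, F => mixedDiff G s D (G.tail a) fun P =>
      F (P ++ a :: G.canonPath (G.head a) w) - F (P ++ G.canonPath (G.tail a) w)

theorem IsDeviation.reach (h : G.IsDeviation s D w) : G.Reach s w := by
  induction D generalizing w with
  | nil => exact h
  | cons a D ih => exact (ih h.2.2).trans h.1.tail_of_head

theorem IsDeviation.reach_of_mem (h : G.IsDeviation s D w) (ha : a ∈ D) :
    G.Reach (G.head a) w := by
  induction D generalizing w with
  | nil => exact absurd ha List.not_mem_nil
  | cons b D ih =>
    rcases List.mem_cons.1 ha with rfl | ha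
    · exact h.1
    · exact (ih h.2.2 ha).trans h.1.tail_of_head

theorem mixedDiff_sub (F F' : List (Fin m) → A) :
    G.mixedDiff s D w (fun P => F P - F' P) = G.mixedDiff s D w F - G.mixedDiff s D w F' := by
  induction D generalizing w F F' with
  | nil => rfl
  | cons a D ih =>
    rw [mixedDiff, mixedDiff, mixedDiff, ← ih]
    congr 1
    funext P
    abel

theorem mixedDiff_zero : G.mixedDiff s D w (fun _ => (0 : A)) = 0 := by
  simpa using mixedDiff_sub (G := G) (s := s) (D := D) (w := w) (fun _ => (0 : A)) fun _ => 0

theorem mixedDiff_cons_const (z : A) : G.mixedDiff s (a :: D) w (fun _ => z) = 0 := by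
  simp only [mixedDiff, sub_self, mixedDiff_zero]

theorem mixedDiff_sum_mul {ι : Type*} [Fintype ι] (q : ι → ℝ) (f : ι → List (Fin m) → ℤ) :
    G.mixedDiff s D w (fun P => ∑ i, q i * (f i P : ℝ)) =
      ∑ i, q i * ((G.mixedDiff s D w (f i) : ℤ) : ℝ) := by
  induction D generalizing w f with
  | nil => rfl
  | cons a D ih =>
    simp only [mixedDiff, ← ih]
    congr 1
    funext P
    simp only [← Finset.sum_sub_distrib, Int.cast_sub, mul_sub]

namespace Acyclic

theorem isWalk_append_canonPath (hG : G.Acyclic) (hP : G.IsWalk s u P) (h : G.Reach u w) :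
    G.IsWalk s w (P ++ G.canonPath u w) :=
  isWalk_append.2 ⟨u, hP, hG.isWalk_canonPath h⟩

theorem isWalk_append_cons_canonPath (hG : G.Acyclic) (hP : G.IsWalk s (G.tail a) P)
    (h : G.Reach (G.head a) w) : G.IsWalk s w (P ++ a :: G.canonPath (G.head a) w) :=
  isWalk_append.2 ⟨_, hP, rfl, hG.isWalk_canonPath h⟩

theorem mixedDiff_congr (hG : G.Acyclic) (hD : G.IsDeviation s D w) {F F' : List (Fin m) → A}
    (hF : ∀ P, G.IsWalk s w P → F P = F' P) : G.mixedDiff s D w F = G.mixedDiff s D w F' := by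
  induction D generalizing w F F' with
  | nil => exact hF _ (hG.isWalk_canonPath hD)
  | cons a D ih =>
    refine ih hD.2.2 fun P hP => ?_
    rw [hF _ (hG.isWalk_append_cons_canonPath hP hD.1),
      hF _ (hG.isWalk_append_canonPath hP hD.1.tail_of_head)]

open Classical in
theorem eq_sum_mixedDiff (hG : G.Acyclic) (F : List (Fin m) → A) {L : List (Fin m)}
    (hL : G.IsWalk s u L.reverse) (h : G.Reach u w) :
    F (L.reverse ++ G.canonPath u w) =
      (L.sublists'.map fun D => if G.IsDeviation s D w then G.mixedDiff s D w F else 0).sum := by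
  induction L generalizing u w F with
  | nil =>
    obtain rfl : s = u := hL
    simp [IsDeviation, h, mixedDiff]
  | cons a L ih =>
    rw [List.reverse_cons] at hL ⊢
    obtain ⟨_, hprefix, rfl, rfl⟩ := isWalk_append.1 hL
    simp only [List.sublists'_cons, List.map_append, List.map_map, List.sum_append,
      Function.comp_def, List.append_assoc, List.singleton_append]
    rw [← ih F hprefix h.tail_of_head]
    by_cases ha : G.IsCanonArc w a
    · simp [IsDeviation, ha, hG.canonPath_tail ha]
    · simp only [IsDeviation, h, ha, not_false_eq_true, true_and, mixedDiff]
      rw [← ih _ hprefix (Reach.refl _), hG.canonPath_self, List.append_nil, add_sub_cancel]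

end Acyclic

theorem sum_map_sublists'_eq (g : List (Fin m) → A) (hg : ∀ D, 2 ≤ D.length → g D = 0)
    (L : List (Fin m)) : (L.sublists'.map g).sum = g [] + (L.map fun a => g [a]).sum := by
  induction L with
  | nil => simp
  | cons a L ih =>
    have hcons : (L.sublists'.map fun D => g (a :: D)).sum = g [a] := by
      clear ih
      induction L with
      | nil => simp
      | cons b L ih =>
        simpa [Function.comp_def, hg] using ih
    simp only [List.sublists'_cons, List.map_append, List.map_map, List.sum_append,
      Function.comp_def, ih, hcons, List.map_cons, List.sum_cons]
    abel

theorem linearCost_eq_sum_map (c : Fin m → ℝ) (hP : P.Nodup) :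
    linearCost c P = (P.map c).sum :=
  List.sum_toFinset c hP

namespace Acyclic

theorem sum_map_ite_tail (hG : G.Acyclic) (hst : s ≠ t) (hP : G.IsWalk s t P) (z : ℝ) :
    (P.map fun a => if G.tail a = s then z else 0).sum = z := by
  cases P with
  | nil => exact absurd hP hst
  | cons a P =>
    obtain ⟨rfl, hP⟩ := hP
    have hrest : ∀ y ∈ P.map fun b => if G.tail b = G.tail a then z else 0, y = 0 := by
      simp only [List.mem_map, forall_exists_index, and_imp, forall_apply_eq_imp_iff₂]
      intro b hb
      exact if_neg fun h : G.tail b = G.tail a => hG.not_reach a (h ▸ hP.reach_tail_of_mem hb)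
    simp [List.sum_eq_zero hrest]

theorem exists_eq_linearCost_iff (hG : G.Acyclic) (hst : s ≠ t) (F : List (Fin m) → ℝ) :
    (∃ c, ∀ P, G.IsWalk s t P → F P = linearCost c P) ↔
      ∀ D, G.IsDeviation s D t → 2 ≤ D.length → G.mixedDiff s D t F = 0 := by
  classical
  constructor
  · rintro ⟨c, hc⟩ (_ | ⟨a, _ | ⟨b, D⟩⟩) hD hlen
    · simp at hlen
    · simp at hlen
    rw [hG.mixedDiff_congr hD fun P hP =>
      (hc P hP).trans (linearCost_eq_sum_map c (hG.nodup hP)), mixedDiff]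
    simp only [List.map_append, List.sum_append, add_sub_add_left_eq_sub, mixedDiff_cons_const]
  · intro hF
    let g (D : List (Fin m)) : ℝ := if G.IsDeviation s D t then G.mixedDiff s D t F else 0
    have hg : ∀ D, 2 ≤ D.length → g D = 0 := fun D hlen => ite_eq_right_iff.2 (hF D · hlen)
    -- The constant `g []` is charged to the first arc of the walk.
    refine ⟨fun a => g [a] + if G.tail a = s then g [] else 0, fun P hP => ?_⟩
    rw [linearCost_eq_sum_map _ (hG.nodup hP), List.sum_map_add, hG.sum_map_ite_tail hst hP]
    have htelescope := hG.eq_sum_mixedDiff F (L := P.reverse) (by rwa [List.reverse_reverse])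
      (Reach.refl t)
    rw [List.reverse_reverse, hG.canonPath_self, List.append_nil] at htelescope
    rw [htelescope, sum_map_sublists'_eq g hg, List.map_reverse, List.sum_reverse, add_comm]

end Acyclic

/-- The indicator, as an integer, that the walk `P` contains the set of arcs `B`. -/
def subsetIndicator (B : Finset (Fin m)) (P : List (Fin m)) : ℤ :=
  if B ⊆ P.toFinset then 1 else 0

theorem orderCost_eq_sum_subsetIndicator {d : ℕ} (q : OrderCost m d) (P : List (Fin m)) :
    orderCost q P = ∑ B, q B * (subsetIndicator B.1 P : ℝ) := by
  simp [orderCost, subsetIndicator, Finset.sum_filter]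

theorem subsetIndicator_append :
    subsetIndicator B (P ++ Q) = subsetIndicator (B \ Q.toFinset) P := by
  rw [subsetIndicator, subsetIndicator, List.toFinset_append]
  exact if_congr sdiff_le_iff'.symm rfl rfl

theorem subsetIndicator_eq_zero (hx : x ∈ B) (hxP : x ∉ P) : subsetIndicator B P = 0 :=
  if_neg fun h => hxP (List.mem_toFinset.1 (h hx))

theorem subsetIndicator_cons_append (hc : c ∈ P ++ Q) (hC : ∀ x ∈ C, x ∉ Q) :
    subsetIndicator (c :: C).toFinset (P ++ Q) = subsetIndicator C.toFinset P := by
  refine if_congr ?_ rfl rfl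
  simp only [Finset.subset_iff, List.mem_toFinset, List.mem_cons, forall_eq_or_imp, hc, true_and]
  exact forall₂_congr fun x hx => by simp [hC x hx]

theorem mixedDiff_cons_subsetIndicator_append (S : List (Fin m)) :
    G.mixedDiff s (a :: D) w (fun P => subsetIndicator B (P ++ S)) =
      G.mixedDiff s D (G.tail a)
          (fun P => subsetIndicator B (P ++ a :: (G.canonPath (G.head a) w ++ S))) -
        G.mixedDiff s D (G.tail a)
          (fun P => subsetIndicator B (P ++ (G.canonPath (G.tail a) w ++ S))) := by
  rw [← mixedDiff_sub, mixedDiff]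
  simp only [List.append_assoc, List.cons_append]

namespace Acyclic

theorem not_mem_of_reach_tail (hG : G.Acyclic) (hQ : G.IsWalk u v Q)
    (hx : G.Reach (G.head x) u) : x ∉ Q :=
  fun hxQ => hG.not_reach x (hx.trans (hQ.reach_tail_of_mem hxQ))

theorem mixedDiff_subsetIndicator_of_card_lt (hG : G.Acyclic) (hD : G.IsDeviation s D w)
    (hB : B.card < D.length) : G.mixedDiff s D w (subsetIndicator B) = 0 := by
  induction D generalizing w B with
  | nil => exact absurd hB (Nat.not_lt_zero _)
  | cons a D ih =>
    set X := a :: G.canonPath (G.head a) w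
    set Y := G.canonPath (G.tail a) w
    have hXw : G.IsWalk (G.tail a) w X := ⟨rfl, hG.isWalk_canonPath hD.1⟩
    have hYw : G.IsWalk (G.tail a) w Y := hG.isWalk_canonPath hD.1.tail_of_head
    -- An arc of `X` or `Y` lies on no walk to the tail of `a`: either it can be removed from `B`,
    -- as it lies on `Q`, or no walk `P ++ Q` contains `B`.
    have hpart : ∀ x ∈ B, x ∈ X ∨ x ∈ Y → ∀ Q : List (Fin m),
        G.mixedDiff s D (G.tail a) (fun P => subsetIndicator B (P ++ Q)) = 0 := by
      intro x hxB hx Q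
      simp only [subsetIndicator_append]
      by_cases hxQ : x ∈ Q
      · refine ih hD.2.2 (Nat.lt_of_succ_lt_succ (lt_of_le_of_lt (Nat.succ_le_of_lt ?_) hB))
        exact Finset.card_lt_card (sdiff_lt_left.2 (Finset.not_disjoint_iff.2 ⟨x, by simpa, hxB⟩))
      · rw [← mixedDiff_zero]
        refine hG.mixedDiff_congr hD.2.2 fun P hP => ?_
        refine subsetIndicator_eq_zero (x := x) (by simp [hxB, hxQ]) fun hxP => ?_
        have hxtail := hP.head_reach_of_mem hxP
        exact hx.elim (hG.not_mem_of_reach_tail hXw hxtail) (hG.not_mem_of_reach_tail hYw hxtail)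
    rw [mixedDiff, mixedDiff_sub]
    by_cases hmeet : ∃ x ∈ B, x ∈ X ∨ x ∈ Y
    · obtain ⟨x, hxB, hx⟩ := hmeet
      rw [hpart x hxB hx, hpart x hxB hx, sub_zero]
    · push Not at hmeet
      simp only [subsetIndicator_append]
      rw [Finset.sdiff_eq_self_of_disjoint, Finset.sdiff_eq_self_of_disjoint, sub_self]
      · exact Finset.disjoint_left.2 fun x hxB => mt List.mem_toFinset.1 (hmeet x hxB).2
      · exact Finset.disjoint_left.2 fun x hxB => mt List.mem_toFinset.1 (hmeet x hxB).1

theorem subsetIndicator_append_sub_subsetIndicator_append (hG : G.Acyclic)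
    (hC : G.IsDeviation s (c :: C) w) (ha : G.Reach (G.head a) w) (hP : G.IsWalk s (G.tail a) P) :
    subsetIndicator (c :: C).toFinset (P ++ a :: G.canonPath (G.head a) w) -
        subsetIndicator (c :: C).toFinset (P ++ G.canonPath (G.tail a) w) =
      if c = a then subsetIndicator C.toFinset P else 0 := by
  set X := a :: G.canonPath (G.head a) w
  set Y := G.canonPath (G.tail a) w
  have hX : G.IsWalk (G.tail a) w X := ⟨rfl, hG.isWalk_canonPath ha⟩
  have hY : G.IsWalk (G.tail a) w Y := hG.isWalk_canonPath ha.tail_of_head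
  have hcanon : ∀ u, c ∉ G.canonPath u w := fun u hc => hC.2.1 (isCanonArc_of_mem_canonPath hc)
  have hC' : G.Reach (G.tail c) (G.tail a) → ∀ x ∈ C, x ∉ X ∧ x ∉ Y := fun hca x hx =>
    have hxa := (hC.2.2.reach_of_mem hx).trans hca
    ⟨hG.not_mem_of_reach_tail hX hxa, hG.not_mem_of_reach_tail hY hxa⟩
  have hzero : ∀ Q, c ∉ Q → subsetIndicator (c :: C).toFinset Q = 0 := fun Q =>
    subsetIndicator_eq_zero (by simp)
  by_cases hca : c = a
  · subst hca
    have hcP : c ∉ P := fun hc => hG.not_reach c (hP.head_reach_of_mem hc)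
    rw [if_pos rfl, subsetIndicator_cons_append (by simp [X]) fun x hx => (hC' (.refl _) x hx).1,
      hzero _ (by simp [hcP, Y, hcanon]), sub_zero]
  · rw [if_neg hca, sub_eq_zero]
    by_cases hcP : c ∈ P
    · have hdisj := hC' (hP.head_reach_of_mem hcP).tail_of_head
      rw [subsetIndicator_cons_append (by simp [hcP]) fun x hx => (hdisj x hx).1,
        subsetIndicator_cons_append (by simp [hcP]) fun x hx => (hdisj x hx).2]
    · rw [hzero _ (by simp [hcP, X, hca, hcanon]), hzero _ (by simp [hcP, Y, hcanon])]

theorem mixedDiff_subsetIndicator_toFinset (hG : G.Acyclic) (hC : G.IsDeviation s C w)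
    (hD : G.IsDeviation s D w) :
    G.mixedDiff s D w (subsetIndicator C.toFinset) = if C = D then 1 else 0 := by
  induction D generalizing w C with
  | nil =>
    cases C with
    | nil => simp [mixedDiff, subsetIndicator]
    | cons c C =>
      rw [mixedDiff, if_neg (List.cons_ne_nil _ _)]
      exact subsetIndicator_eq_zero (x := c) (by simp) (hC.2.1 <| isCanonArc_of_mem_canonPath ·)
  | cons a D ih =>
    obtain ⟨haw, -, hD⟩ := hD
    cases C with
    | nil => simp [mixedDiff, subsetIndicator, mixedDiff_zero]
    | cons c C =>
      rw [mixedDiff, hG.mixedDiff_congr hD fun P hP =>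
        hG.subsetIndicator_append_sub_subsetIndicator_append hC haw hP]
      by_cases hca : c = a
      · subst hca
        simp [ih hC.2.2 hD]
      · simp [hca, mixedDiff_zero]

theorem linearizable_iff (hG : G.Acyclic) (hst : s ≠ t) {d : ℕ} (q : OrderCost m d) :
    G.Linearizable s t q ↔ ∀ D, G.IsDeviation s D t → 2 ≤ D.length → D.length ≤ d →
      ∑ B, q B * ((G.mixedDiff s D t (subsetIndicator B.1) : ℤ) : ℝ) = 0 := by
  simp only [Linearizable, hG.isPath_iff]
  rw [hG.exists_eq_linearCost_iff hst, funext (orderCost_eq_sum_subsetIndicator q)]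
  simp only [mixedDiff_sum_mul]
  refine forall₃_congr fun D hD _ => ⟨fun h _ => h, fun h => ?_⟩
  rcases le_or_gt D.length d with hd | hd
  · exact h hd
  · exact Finset.sum_eq_zero fun B _ => by
      rw [hG.mixedDiff_subsetIndicator_of_card_lt hD (B.2.trans_lt hd), Int.cast_zero, mul_zero]

end Acyclic

end MixedDifferences

section LinearCosts

variable {n m d : ℕ} {G : ArcDigraph n m} {s t : Fin n}

/-- The obstructions to linearizability: the deviations of at least two and at most `d` arcs. -/
abbrev Obstruction (G : ArcDigraph n m) (s t : Fin n) (d : ℕ) : Type :=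
  {D : List (Fin m) // G.IsDeviation s D t ∧ 2 ≤ D.length ∧ D.length ≤ d}

noncomputable instance : Fintype (G.Obstruction s t d) :=
  ((List.finite_length_le (Fin m) d).subset fun _ hD => hD.2.2).fintype

/-- The set of arcs of an obstruction, a pivot column of the obstruction matrix. -/
def pivot (G : ArcDigraph n m) (s t : Fin n) (d : ℕ) (D : G.Obstruction s t d) : ArcSubset m d :=
  ⟨D.1.toFinset, D.1.toFinset_card_le.trans D.2.2.2⟩

/-- The matrix of the mixed differences along the obstructions, as linear forms in the cost
function. -/
noncomputable def obstructionMatrix (G : ArcDigraph n m) (s t : Fin n) (d : ℕ) :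
    Matrix (G.Obstruction s t d) (ArcSubset m d) ℤ :=
  fun D B => G.mixedDiff s D.1 t (subsetIndicator B.1)

namespace Acyclic

theorem obstructionMatrix_submatrix_pivot (hG : G.Acyclic) :
    (G.obstructionMatrix s t d).submatrix id (G.pivot s t d) = 1 := by
  ext C D
  refine (hG.mixedDiff_subsetIndicator_toFinset D.2.1 C.2.1).trans ?_
  simp only [Matrix.one_apply, Subtype.ext_iff, eq_comm]

theorem mem_ker_obstructionMatrix_iff (hG : G.Acyclic) (hst : s ≠ t) (q : OrderCost m d) :
    q ∈ LinearMap.ker ((G.obstructionMatrix s t d).map (Int.cast : ℤ → ℝ)).mulVecLin ↔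
      G.Linearizable s t q := by
  simp [hG.linearizable_iff hst, funext_iff, Matrix.mulVec, dotProduct, obstructionMatrix,
    mul_comm]

theorem exists_basis_ker_obstructionMatrix {K : ℕ} (hG : G.Acyclic)
    (g : Fin K ≃ {C // C ∉ Set.range (G.pivot s t d)}) :
    ∃ b : Module.Basis (Fin K) ℝ (LinearMap.ker
        ((G.obstructionMatrix s t d).map (Int.cast : ℤ → ℝ)).mulVecLin),
      ∀ j B, (b j : OrderCost m d) B =
        pivotProj (G.obstructionMatrix s t d) (G.pivot s t d) B (g j).1 := by
  have hpivot : ((G.obstructionMatrix s t d).map (Int.cast : ℤ → ℝ)).submatrix id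
      (G.pivot s t d) = 1 := by
    rw [Matrix.submatrix_map, hG.obstructionMatrix_submatrix_pivot,
      Matrix.map_one _ Int.cast_zero Int.cast_one]
  obtain ⟨b, hb⟩ := exists_basis_ker_mulVecLin hpivot
  refine ⟨b.reindex g.symm, fun j B => ?_⟩
  rw [b.reindex_apply, g.symm_symm, hb]
  exact congrFun₂ (pivotProj_map (Int.castRingHom ℝ) _ _) B (g j).1

end Acyclic

end LinearCosts

section BoundedReachability

variable {n m : ℕ} {G : ArcDigraph n m} {E : Fin m → Prop} {u v : Fin n} {r : ℕ}

/-- There is a walk from `u` to `v` of at most `r` arcs, all of which have the property `E`. -/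
def ReachWithin (G : ArcDigraph n m) (E : Fin m → Prop) (r : ℕ) (u v : Fin n) : Prop :=
  ∃ p, G.IsWalk u v p ∧ p.length ≤ r ∧ ∀ a ∈ p, E a

theorem reachWithin_iff : G.ReachWithin E r u v ↔
    u = v ∨ r ≠ 0 ∧ ∃ a, G.tail a = u ∧ E a ∧ G.ReachWithin E (r - 1) (G.head a) v := by
  constructor
  · rintro ⟨_ | ⟨a, p⟩, hp, hr, hE⟩
    · exact .inl hp
    · rw [List.length_cons] at hr
      rw [List.forall_mem_cons] at hE
      exact .inr ⟨by omega, a, hp.1, hE.1, p, hp.2, by omega, hE.2⟩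
  · rintro (rfl | ⟨hr, a, rfl, ha, p, hp, hpr, hE⟩)
    · exact ⟨[], rfl, r.zero_le, by simp⟩
    · exact ⟨a :: p, ⟨rfl, hp⟩, by rw [List.length_cons]; omega, List.forall_mem_cons.2 ⟨ha, hE⟩⟩

theorem Acyclic.reachWithin_card (hG : G.Acyclic) :
    G.ReachWithin E n u v ↔ G.ReachVia E u v :=
  exists_congr fun _ => and_congr_right fun hp => and_iff_right (hG.length_lt hp).le

end BoundedReachability

end ArcDigraph

namespace RAM

/-- Started in `σ`, the program `p` halts within `c` steps in a state with the property `Post`. -/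
def Runs (p : Prog) (σ : State) (c : ℕ) (Post : State → Prop) : Prop :=
  ∃ k τ, Exec p σ k τ ∧ k ≤ c ∧ Post τ

namespace Runs

variable {p q : Prog} {x i : Expr} {σ : State} {a c c' : ℕ} {Mid Post Post' : State → Prop}

theorem mono (h : Runs p σ c Post) (hc : c ≤ c') (hP : ∀ τ, Post τ → Post' τ) :
    Runs p σ c' Post' := by
  obtain ⟨k, τ, hexec, hk, hτ⟩ := h
  exact ⟨k, τ, hexec, hk.trans hc, hP τ hτ⟩

theorem skip (h : Post σ) : Runs .skip σ 1 Post :=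
  ⟨1, σ, .skip σ, le_rfl, h⟩

theorem write (h : Post (σ.write a (i.eval σ.mem) (x.eval σ.mem))) :
    Runs (.write a i x) σ (i.cost + x.cost + 1) Post :=
  ⟨_, _, .write σ a i x, le_rfl, h⟩

theorem emit (h : Post (σ.emit (x.eval σ.mem))) : Runs (.emit x) σ (x.cost + 1) Post :=
  ⟨_, _, .emit σ x, le_rfl, h⟩

theorem seq (hp : Runs p σ c Mid) (hq : ∀ τ, Mid τ → Runs q τ c' Post) :
    Runs (.seq p q) σ (c + c') Post := by
  obtain ⟨k, τ, hexec, hk, hτ⟩ := hp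
  obtain ⟨l, υ, hexec', hl, hυ⟩ := hq τ hτ
  exact ⟨k + l, υ, .seq hexec hexec', Nat.add_le_add hk hl, hυ⟩

theorem ite (hp : x.eval σ.mem ≠ 0 → Runs p σ c Post) (hq : x.eval σ.mem = 0 → Runs q σ c' Post) :
    Runs (.ite x p q) σ (x.cost + 1 + (c + c')) Post := by
  by_cases hx : x.eval σ.mem = 0
  · obtain ⟨k, τ, hexec, hk, hτ⟩ := hq hx
    exact ⟨_, τ, .ite_false hx hexec, by omega, hτ⟩
  · obtain ⟨k, τ, hexec, hk, hτ⟩ := hp hx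
    exact ⟨_, τ, .ite_true hx hexec, by omega, hτ⟩

theorem whileLoop {R : ℕ} {I : ℕ → State → Prop}
    (htest : ∀ j ≤ R, ∀ τ, I j τ → x.eval τ.mem = if j < R then 1 else 0)
    (hbody : ∀ j < R, ∀ τ, I j τ → Runs p τ c (I (j + 1))) (h0 : I 0 σ) :
    Runs (.while x p) σ (R * (c + x.cost + 1) + x.cost + 1) (I R) := by
  suffices H : ∀ r j, j + r = R → ∀ τ, I j τ →
      Runs (.while x p) τ (r * (c + x.cost + 1) + x.cost + 1) (I R) from H R 0 (by omega) σ h0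
  intro r
  induction r with
  | zero =>
    rintro j rfl τ hτ
    exact ⟨_, τ, .while_false (by rw [htest j le_rfl τ hτ, if_neg (by omega)]), by omega, hτ⟩
  | succ r ih =>
    intro j hj τ hτ
    obtain ⟨k, υ, hexec, hk, hυ⟩ := hbody j (by omega) τ hτ
    obtain ⟨l, ω, hexec', hl, hω⟩ := ih (j + 1) (by omega) υ hυ
    have htrue : x.eval τ.mem ≠ 0 := by
      rw [htest j (by omega) τ hτ, if_pos (by omega)]
      exact one_ne_zero
    refine ⟨_, ω, .while_true htrue hexec hexec', ?_, hω⟩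
    rw [Nat.succ_mul]
    omega

end Runs

theorem State.write_mem_self (σ : State) (a : ℕ) (i v : ℤ) : (σ.write a i v).mem a i = v := by
  simp only [State.write, Function.update_self]

theorem State.write_mem_of_ne (σ : State) {a b : ℕ} {i j : ℤ} (v : ℤ) (h : b ≠ a ∨ j ≠ i) :
    (σ.write a i v).mem b j = σ.mem b j := by
  by_cases hb : b = a
  · subst hb
    simp only [State.write, Function.update_self,
      Function.update_of_ne (h.resolve_left (not_not_intro rfl))]
  · simp only [State.write, Function.update_of_ne hb]

/-- Register `i`. The registers form array `1`. -/
abbrev reg (i : ℕ) : Expr := .read 1 (.const i)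

/-- The assignment of `x` to register `i`. -/
abbrev setReg (i : ℕ) (x : Expr) : Prog := .write 1 (.const i) x

/-- The common length of all loops, stored in array `3` because the even arrays hold the tables. -/
abbrev bound : Expr := .read 3 (.const 0)

/-- Runs `body` with the values `0, 1, …` below `bound` in register `c`. -/
def forLoop (c : ℕ) (body : Prog) : Prog :=
  .seq (setReg c (.const 0))
    (.while (.lt (reg c) bound) (.seq body (setReg c (.add (reg c) (.const 1)))))

theorem Runs.forLoop {R c cost : ℕ} {body : Prog} {I : ℕ → State → Prop} {σ : State}
    (hbound : ∀ j τ, I j τ → bound.eval τ.mem = R)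
    (hstable : ∀ j τ v, I j τ → I j (τ.write 1 c v))
    (hbody : ∀ j < R, ∀ τ, I j τ → τ.mem 1 c = j →
      Runs body τ cost fun υ => I (j + 1) υ ∧ υ.mem 1 c = j)
    (h0 : I 0 σ) : Runs (forLoop c body) σ (R * (cost + 12) + 9) (I R) := by
  let J (j : ℕ) (τ : State) : Prop := I j τ ∧ τ.mem 1 c = j
  have hwhile : ∀ τ, J 0 τ → Runs (.while (.lt (reg c) bound)
      (.seq body (setReg c (.add (reg c) (.const 1))))) τ
      (R * (cost + 6 + 5 + 1) + 5 + 1) (J R) := by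
    intro τ hτ
    refine Runs.whileLoop (I := J) ?_ ?_ hτ
    · intro j _ υ hυ
      have := hbound j υ hυ.1
      simp_all [J, Expr.eval]
    · intro j hj υ hυ
      refine (hbody j hj υ hυ.1 hυ.2).seq fun ω hω => Runs.write ⟨hstable _ _ _ hω.1, ?_⟩
      simp [Expr.eval, State.write_mem_self, hω.2]
  refine ((Runs.write (Post := J 0) ⟨hstable _ _ _ h0, ?_⟩).seq hwhile).mono ?_ fun _ hτ => hτ.1
  · simp [Expr.eval, State.write_mem_self]
  · simp only [Expr.cost]
    linarith

section Compilation

/-- The binary operations of the machine. -/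
inductive BinOp : Type
  | add
  | sub
  | lt
  | eq

/-- The machine expression of a binary operation. -/
def BinOp.expr : BinOp → Expr → Expr → Expr
  | add => .add
  | sub => .sub
  | lt => .lt
  | eq => .eq

/-- The value of a binary operation. -/
def BinOp.eval : BinOp → ℤ → ℤ → ℤ
  | add, a, b => a + b
  | sub, a, b => a - b
  | lt, a, b => if a < b then 1 else 0
  | eq, a, b => if a = b then 1 else 0

theorem BinOp.eval_expr (o : BinOp) (x y : Expr) (μ : ℕ → ℤ → ℤ) :
    (o.expr x y).eval μ = o.eval (x.eval μ) (y.eval μ) := by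
  cases o <;> rfl

theorem BinOp.cost_expr (o : BinOp) (x y : Expr) :
    (o.expr x y).cost = x.cost + y.cost + 1 := by
  cases o <;> rfl

/-- Terms over integer variables and integer tables with conditionals and bounded sums. They are
evaluated in a range `R`: the variable of a sum takes the values `0, …, R - 1`. -/
inductive Term : Type
  | const (z : ℤ)
  | var (x : ℕ)
  | tab (t : ℕ) (i : Term)
  | op (o : BinOp) (x y : Term)
  | ite (c x y : Term)
  | sum (x : ℕ) (e : Term)

/-- The value of a term in the range `R`, with tables `T` and variables `ρ`. -/
def Term.eval (R : ℕ) (T : ℕ → ℤ → ℤ) (ρ : ℕ → ℤ) : Term → ℤ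
  | const z => z
  | var x => ρ x
  | tab t i => T t (i.eval R T ρ)
  | op o x y => o.eval (x.eval R T ρ) (y.eval R T ρ)
  | ite c x y => if c.eval R T ρ ≠ 0 then x.eval R T ρ else y.eval R T ρ
  | sum x e => ∑ j ∈ Finset.range R, e.eval R T (Function.update ρ x j)

/-- The program which computes a term in register `k`, using only the registers from `k` on, if
variable `x` is kept in register `loc x` with `loc x < k` and table `t` in array `2 * t`. -/
def Term.compile (loc : ℕ → ℕ) (k : ℕ) : Term → Prog
  | const z => setReg k (.const z)
  | var x => setReg k (reg (loc x))
  | tab t i => .seq (i.compile loc k) (setReg k (.read (2 * t) (reg k)))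
  | op o x y =>
      .seq (x.compile loc k)
        (.seq (y.compile loc (k + 1)) (setReg k (o.expr (reg k) (reg (k + 1)))))
  | ite c x y => .seq (c.compile loc k) (.ite (reg k) (x.compile loc k) (y.compile loc k))
  | sum x e =>
      .seq (setReg k (.const 0)) (forLoop (k + 1)
        (.seq (e.compile (Function.update loc x (k + 1)) (k + 2))
          (setReg k (.add (reg k) (reg (k + 2))))))

/-- Commands on tables: `when` is a conditional and `loop x p` runs `p` for the values
`0, …, R - 1` of the variable `x`. -/
inductive Cmd : Type
  | store (t : ℕ) (i e : Term)
  | emit (e : Term)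
  | seq (p q : Cmd)
  | when (e : Term) (p : Cmd)
  | loop (x : ℕ) (p : Cmd)

/-- The effect of a command in the range `R` on a state, whose memory holds the tables. -/
def Cmd.run (R : ℕ) (ρ : ℕ → ℤ) : Cmd → State → State
  | store t i e, τ => τ.write t (i.eval R τ.mem ρ) (e.eval R τ.mem ρ)
  | emit e, τ => τ.emit (e.eval R τ.mem ρ)
  | seq p q, τ => q.run R ρ (p.run R ρ τ)
  | when e p, τ => if e.eval R τ.mem ρ ≠ 0 then p.run R ρ τ else τ
  | loop x p, τ => (List.range R).foldl (fun υ (j : ℕ) => p.run R (Function.update ρ x j) υ) τ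

/-- The program of a command, which uses the registers from `k` on. -/
def Cmd.compile (loc : ℕ → ℕ) (k : ℕ) : Cmd → Prog
  | store t i e =>
      .seq (i.compile loc k)
        (.seq (e.compile loc (k + 1)) (.write (2 * t) (reg k) (reg (k + 1))))
  | emit e => .seq (e.compile loc k) (.emit (reg k))
  | seq p q => .seq (p.compile loc k) (q.compile loc k)
  | when e p => .seq (e.compile loc k) (.ite (reg k) (p.compile loc k) .skip)
  | loop x p => forLoop k (p.compile (Function.update loc x k) (k + 1))

/-- The machine state `σ` represents the state `τ` of a command in the range `R`, and the
registers below `k` have the values `f`. -/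
structure Represents (R k : ℕ) (f : ℕ → ℤ) (τ σ : State) : Prop where
  table : ∀ t, σ.mem (2 * t) = τ.mem t
  bound : σ.mem 3 0 = R
  out : σ.out = τ.out
  reg : ∀ i < k, σ.mem 1 i = f i

variable {R k : ℕ} {loc : ℕ → ℕ} {f : ℕ → ℤ} {τ σ : State}

namespace Represents

theorem write_reg (h : Represents R k f τ σ) {c : ℕ} (hc : k ≤ c) (v : ℤ) :
    Represents R k f τ (σ.write 1 c v) where
  table t := by
    funext i
    rw [State.write_mem_of_ne _ _ (.inl (by omega)), h.table]
  bound := by rw [State.write_mem_of_ne _ _ (.inl (by omega)), h.bound]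
  out := h.out
  reg i hi := by rw [State.write_mem_of_ne _ _ (.inr (by omega)), h.reg i hi]

theorem write_table (h : Represents R k f τ σ) (t : ℕ) (i v : ℤ) :
    Represents R k f (τ.write t i v) (σ.write (2 * t) i v) where
  table t' := by
    rcases eq_or_ne t' t with rfl | ht
    · simp only [State.write, Function.update_self, h.table]
    · simp only [State.write, Function.update_of_ne ht, h.table,
        Function.update_of_ne (show 2 * t' ≠ 2 * t by omega)]
  bound := by rw [State.write_mem_of_ne _ _ (.inl (by omega)), h.bound]
  out := h.out
  reg i hi := by rw [State.write_mem_of_ne _ _ (.inl (by omega)), h.reg i hi]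

theorem push {v : ℤ} (h : Represents R k f τ σ) (hv : σ.mem 1 k = v) :
    Represents R (k + 1) (Function.update f k v) τ σ where
  __ := h
  reg i hi := by
    rcases (Nat.lt_succ_iff_lt_or_eq.1 hi) with hi | rfl
    · rw [Function.update_of_ne hi.ne, h.reg i hi]
    · rw [Function.update_self, hv]

theorem top_eq {v : ℤ} (h : Represents R (k + 1) (Function.update f k v) τ σ) :
    σ.mem 1 k = v := by
  rw [h.reg k k.lt_succ_self, Function.update_self]

theorem pop {v : ℤ} (h : Represents R (k + 1) (Function.update f k v) τ σ) :
    Represents R k f τ σ where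
  __ := h
  reg i hi := by rw [h.reg i (hi.trans k.lt_succ_self), Function.update_of_ne hi.ne]

end Represents

theorem update_comp_of_forall_lt (hloc : ∀ x, loc x < k) (f : ℕ → ℤ) (v : ℤ) :
    Function.update f k v ∘ loc = f ∘ loc :=
  funext fun x => Function.update_of_ne (hloc x).ne _ _

theorem update_comp_update (hloc : ∀ x, loc x < k) (f : ℕ → ℤ) (x : ℕ) (v : ℤ) :
    Function.update f k v ∘ Function.update loc x k = Function.update (f ∘ loc) x v := by
  rw [Function.comp_update, update_comp_of_forall_lt hloc, Function.update_self]

theorem update_lt_succ (hloc : ∀ x, loc x < k) (x y : ℕ) : Function.update loc x k y < k + 1 := by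
  rcases eq_or_ne y x with rfl | hy
  · rw [Function.update_self]
    exact k.lt_succ_self
  · rw [Function.update_of_ne hy]
    exact (hloc y).trans k.lt_succ_self

/-- `e.compile loc k` computes the value of `e` in polynomially many steps. -/
def Term.Computes (e : Term) (loc : ℕ → ℕ) (k : ℕ) : Prop :=
  ∃ C : Polynomial ℕ, ∀ R f τ σ, Represents R k f τ σ →
    Runs (e.compile loc k) σ (C.eval R)
      (Represents R (k + 1) (Function.update f k (e.eval R τ.mem (f ∘ loc))) τ)

namespace Term

variable {c e x y i : Term}

theorem Computes.tab (t : ℕ) (hi : i.Computes loc k) : (tab t i).Computes loc k := by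
  obtain ⟨C, hC⟩ := hi
  refine ⟨C + 6, fun R f τ σ h => ?_⟩
  refine ((hC R f τ σ h).seq fun υ hυ => Runs.write ((hυ.pop.write_reg le_rfl _).push ?_)).mono
    (by simp [Expr.cost]) fun _ => id
  simp only [Expr.eval, State.write_mem_self, hυ.top_eq, hυ.table, eval]

theorem Computes.op (o : BinOp) (hloc : ∀ v, loc v < k) (hx : x.Computes loc k)
    (hy : y.Computes loc (k + 1)) : (op o x y).Computes loc k := by
  obtain ⟨C, hC⟩ := hx
  obtain ⟨D, hD⟩ := hy
  refine ⟨C + (D + 7), fun R f τ σ h => ?_⟩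
  refine ((hC R f τ σ h).seq fun υ hυ => (hD R _ τ υ hυ).seq fun ω hω =>
    Runs.write ((hω.pop.pop.write_reg le_rfl _).push ?_)).mono
    (by simp [Expr.cost, BinOp.cost_expr]) fun _ => id
  simp only [Expr.eval, State.write_mem_self, BinOp.eval_expr, hω.pop.top_eq, hω.top_eq,
    update_comp_of_forall_lt hloc, eval]

theorem Computes.ite (hc : c.Computes loc k) (hx : x.Computes loc k) (hy : y.Computes loc k) :
    (ite c x y).Computes loc k := by
  obtain ⟨C, hC⟩ := hc
  obtain ⟨D, hD⟩ := hx
  obtain ⟨E, hE⟩ := hy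
  refine ⟨C + (3 + (D + E)), fun R f τ σ h => ?_⟩
  refine ((hC R f τ σ h).seq fun υ hυ => Runs.ite (c := D.eval R) (c' := E.eval R)
    (fun htest => ?_) fun htest => ?_).mono (by simp [Expr.cost]) fun _ => id
  · rw [eval, if_pos (hυ.top_eq ▸ htest)]
    exact hD R f τ υ hυ.pop
  · rw [eval, if_neg (not_not_intro (hυ.top_eq ▸ htest))]
    exact hE R f τ υ hυ.pop

theorem Computes.sum (v : ℕ) (hloc : ∀ v, loc v < k)
    (he : e.Computes (Function.update loc v (k + 1)) (k + 2)) : (sum v e).Computes loc k := by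
  obtain ⟨C, hC⟩ := he
  refine ⟨3 + (Polynomial.X * (C + 7 + 12) + 9), fun R f τ σ h => ?_⟩
  let g (j : ℕ) : ℕ → ℤ := Function.update f k
    (∑ l ∈ Finset.range j, e.eval R τ.mem (Function.update (f ∘ loc) v l))
  have hbody : ∀ j < R, ∀ υ, Represents R (k + 1) (g j) τ υ → υ.mem 1 (k + 1 : ℕ) = j →
      Runs (.seq (e.compile (Function.update loc v (k + 1)) (k + 2))
        (setReg k (.add (reg k) (reg (k + 2))))) υ (C.eval R + 7)
        fun ω => Represents R (k + 1) (g (j + 1)) τ ω ∧ ω.mem 1 (k + 1 : ℕ) = j := by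
    intro j _ υ hυ hj
    refine (hC R _ τ υ (hυ.push hj)).seq fun ω hω =>
      Runs.write ⟨(hω.pop.pop.pop.write_reg le_rfl _).push ?_, ?_⟩
    · simp only [Expr.eval, State.write_mem_self, hω.pop.pop.top_eq, hω.top_eq,
        update_comp_update fun x => (hloc x).trans k.lt_succ_self, g,
        update_comp_of_forall_lt hloc, Finset.sum_range_succ]
    · rw [State.write_mem_of_ne _ _ (.inr (by simp [Expr.eval])), hω.pop.top_eq]
  refine ((Runs.write (Post := Represents R (k + 1) (g 0) τ)
    ((h.write_reg le_rfl _).push ?_)).seq fun υ hυ =>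
    Runs.forLoop (fun j υ hυ => hυ.bound) (fun j υ z hυ => hυ.write_reg le_rfl z) hbody hυ).mono
    (by simp [Expr.cost]) fun _ => id
  simp [Expr.eval, State.write_mem_self]

theorem computes (e : Term) (hloc : ∀ v, loc v < k) : e.Computes loc k := by
  induction e generalizing loc k with
  | const z =>
    refine ⟨3, fun R f τ σ h => (Runs.write ((h.write_reg le_rfl _).push ?_)).mono
      (by simp [Expr.cost]) fun _ => id⟩
    simp only [Expr.eval, State.write_mem_self, eval]
  | var v =>
    refine ⟨4, fun R f τ σ h => (Runs.write ((h.write_reg le_rfl _).push ?_)).mono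
      (by simp [Expr.cost]) fun _ => id⟩
    simp only [Expr.eval, State.write_mem_self, h.reg _ (hloc v), eval, Function.comp_apply]
  | tab t i hi => exact (hi hloc).tab t
  | op o x y hx hy => exact (hx hloc).op o hloc (hy fun v => (hloc v).trans k.lt_succ_self)
  | ite c x y hc hx hy => exact (hc hloc).ite (hx hloc) (hy hloc)
  | sum v e he =>
    exact (he (update_lt_succ (fun x => (hloc x).trans k.lt_succ_self) v)).sum v hloc

end Term

/-- `p.compile loc k` has the effect of the command `p` in polynomially many steps. -/
def Cmd.Computes (p : Cmd) (loc : ℕ → ℕ) (k : ℕ) : Prop :=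
  ∃ C : Polynomial ℕ, ∀ R f τ σ, Represents R k f τ σ →
    Runs (p.compile loc k) σ (C.eval R) (Represents R k f (p.run R (f ∘ loc) τ))

namespace Cmd

variable {p q : Cmd}

theorem computes_store (t : ℕ) (i e : Term) (hloc : ∀ v, loc v < k) :
    (store t i e).Computes loc k := by
  obtain ⟨C, hC⟩ := i.computes hloc
  obtain ⟨D, hD⟩ := e.computes fun v => (hloc v).trans k.lt_succ_self
  refine ⟨C + (D + 5), fun R f τ σ h => ?_⟩
  refine ((hC R f τ σ h).seq fun υ hυ => (hD R _ τ υ hυ).seq fun ω hω => Runs.write ?_).mono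
    (by simp [Expr.cost]) fun _ => id
  simp only [Expr.eval, hω.pop.top_eq, hω.top_eq, update_comp_of_forall_lt hloc, run]
  exact hω.pop.pop.write_table t _ _

theorem computes_emit (e : Term) (hloc : ∀ v, loc v < k) : (emit e).Computes loc k := by
  obtain ⟨C, hC⟩ := e.computes hloc
  refine ⟨C + 3, fun R f τ σ h => ?_⟩
  refine ((hC R f τ σ h).seq fun υ hυ => Runs.emit ?_).mono (by simp [Expr.cost]) fun _ => id
  simp only [Expr.eval, hυ.top_eq, run]
  exact { hυ.pop with out := congrArg (· ++ _) hυ.out }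

theorem Computes.seq (hp : p.Computes loc k) (hq : q.Computes loc k) :
    (seq p q).Computes loc k := by
  obtain ⟨C, hC⟩ := hp
  obtain ⟨D, hD⟩ := hq
  exact ⟨C + D, fun R f τ σ h => ((hC R f τ σ h).seq fun υ hυ => hD R f _ υ hυ).mono
    (by simp) fun _ => id⟩

theorem Computes.when (e : Term) (hloc : ∀ v, loc v < k) (hp : p.Computes loc k) :
    (when e p).Computes loc k := by
  obtain ⟨C, hC⟩ := e.computes hloc
  obtain ⟨D, hD⟩ := hp
  refine ⟨C + (3 + (D + 1)), fun R f τ σ h => ?_⟩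
  refine ((hC R f τ σ h).seq fun υ hυ => Runs.ite (c := D.eval R) (fun htest => ?_) fun htest =>
    Runs.skip ?_).mono (by simp [Expr.cost]) fun _ => id
  · rw [run, if_pos (hυ.top_eq ▸ htest)]
    exact hD R f τ υ hυ.pop
  · rw [run, if_neg (not_not_intro (hυ.top_eq ▸ htest))]
    exact hυ.pop

theorem Computes.loop (x : ℕ) (hloc : ∀ v, loc v < k)
    (hp : p.Computes (Function.update loc x k) (k + 1)) : (loop x p).Computes loc k := by
  obtain ⟨C, hC⟩ := hp
  refine ⟨Polynomial.X * (C + 12) + 9, fun R f τ σ h => ?_⟩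
  let I (j : ℕ) : State → Prop := Represents R k f ((List.range j).foldl
    (fun υ (j : ℕ) => p.run R (Function.update (f ∘ loc) x j) υ) τ)
  refine (Runs.forLoop (I := I) (cost := C.eval R) (fun j υ hυ => hυ.bound)
    (fun j υ v hυ => hυ.write_reg le_rfl v) ?_ h).mono (by simp) fun _ => id
  intro j _ υ hυ hj
  refine (hC R _ _ υ (hυ.push hj)).mono le_rfl fun ω hω => ⟨?_, hω.top_eq⟩
  rw [update_comp_update hloc] at hω
  simpa only [I, List.range_succ, List.foldl_append, List.foldl_cons, List.foldl_nil] using hω.pop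

theorem computes (p : Cmd) (hloc : ∀ v, loc v < k) : p.Computes loc k := by
  induction p generalizing loc k with
  | store t i e => exact computes_store t i e hloc
  | emit e => exact computes_emit e hloc
  | seq p q hp hq => exact (hp hloc).seq (hq hloc)
  | when e p hp => exact (hp hloc).when e hloc
  | loop x p hp => exact (hp (update_lt_succ hloc x)).loop x hloc

end Cmd

/-- A term with the value `R ^ e` in the range `R`. -/
def Term.power : ℕ → Term
  | 0 => .const 1
  | e + 1 => .sum 0 (power e)

theorem Term.eval_power (R e : ℕ) (T : ℕ → ℤ → ℤ) (ρ : ℕ → ℤ) :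
    (power e).eval R T ρ = (R : ℤ) ^ e := by
  induction e generalizing ρ with
  | zero => rfl
  | succ e ih =>
    simp only [power, eval, ih, Finset.sum_const, Finset.card_range, nsmul_eq_mul, pow_succ']

theorem Represents.write_bound (h : Represents R k f τ σ) (R' : ℕ) :
    Represents R' k f τ (σ.write 3 0 R') where
  table t := by
    funext i
    rw [State.write_mem_of_ne _ _ (.inl (by omega)), h.table]
  bound := State.write_mem_self _ _ _ _
  out := h.out
  reg i hi := by rw [State.write_mem_of_ne _ _ (.inl (by omega)), h.reg i hi]

theorem represents_initial (w : List ℤ) : Represents 0 1 0 (initial w) (initial w) where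
  table t := by simp [initial]
  bound := by simp [initial]
  out := rfl
  reg i _ := by simp [initial]

namespace Cmd

/-- The program which runs the command `p` in the range `(n + m + 2) ^ e`, where `n` and `m` are
the first two entries of the input word. -/
def toProg (e : ℕ) (p : Cmd) : Prog :=
  .seq (.write 3 (.const 0)
      (.add (.add (.read 0 (.const 0)) (.read 0 (.const 1))) (.const 2)))
    (.seq ((Term.power e).compile (fun _ => 0) 1)
      (.seq (.write 3 (.const 0) (reg 1)) (p.compile (fun _ => 0) 1)))

theorem exists_polynomial_exec_toProg (e : ℕ) (p : Cmd) :
    ∃ T : Polynomial ℕ, ∀ (n m : ℕ) (w : List ℤ), w.getD 0 0 = n → w.getD 1 0 = m →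
      ∃ steps final, Exec (p.toProg e) (initial w) steps final ∧ steps ≤ T.eval (n + m) ∧
        final.out = (p.run ((n + m + 2) ^ e) 0 (initial w)).out := by
  have hloc : ∀ v : ℕ, (fun _ => 0) v < 1 := fun _ => one_pos
  obtain ⟨C, hC⟩ := (Term.power e).computes hloc
  obtain ⟨D, hD⟩ := p.computes hloc
  refine ⟨9 + (C.comp (.X + 2) + (4 + D.comp ((.X + 2) ^ e))), fun n m w hn hm => ?_⟩
  have hrange : ((Expr.read 0 (.const 0)).add (.read 0 (.const 1)) |>.add (.const 2)).eval
      (initial w).mem = (n + m + 2 : ℕ) := by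
    rw [List.getD_eq_getElem?_getD] at hn hm
    simp [Expr.eval, initial, hn, hm]
  obtain ⟨steps, final, hexec, hsteps, hfinal⟩ : Runs (p.toProg e) (initial w) _
      (Represents ((n + m + 2) ^ e) 1 0 (p.run ((n + m + 2) ^ e) 0 (initial w))) := by
    refine (Runs.write (Post := Represents (n + m + 2) 1 0 (initial w)) ?_).seq fun σ hσ =>
      (hC _ _ _ σ hσ).seq fun υ hυ => (Runs.write (Post :=
        Represents ((n + m + 2) ^ e) 1 0 (initial w)) ?_).seq fun ω hω => hD _ _ _ ω hω
    · rw [hrange]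
      exact (represents_initial w).write_bound _
    · have hpower : (reg 1).eval υ.mem = ((n + m + 2) ^ e : ℕ) := by
        rw [Expr.eval, Expr.eval, hυ.top_eq, Term.eval_power, Nat.cast_pow]
      rw [hpower]
      exact hυ.pop.write_bound _
  refine ⟨steps, final, hexec, hsteps.trans ?_, hfinal.out⟩
  simp [Expr.cost]

end Cmd

end Compilation

section Outputs

variable {R : ℕ} {T : ℕ → ℤ → ℤ} {ρ : ℕ → ℤ}

namespace Term

/-- Truth of a term: every value other than `0` counts as true. -/
def Holds (R : ℕ) (T : ℕ → ℤ → ℤ) (ρ : ℕ → ℤ) (e : Term) : Prop :=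
  e.eval R T ρ ≠ 0

instance (e : Term) : Decidable (Holds R T ρ e) := inferInstanceAs (Decidable (_ ≠ _))

/-- The value `1` if the condition `e` holds, and `0` otherwise. -/
def indicator (e : Term) : Term := ite e (const 1) (const 0)

/-- Negation of a condition. -/
def not (e : Term) : Term := ite e (const 0) (const 1)

/-- Conjunction of two conditions; `y` is evaluated only if `x` holds. -/
def and (x y : Term) : Term := ite x y (const 0)

/-- Disjunction of two conditions. -/
def or (x y : Term) : Term := ite x (const 1) y

/-- The existence of a value of the variable `v` below `R`. -/
def any (v : ℕ) (e : Term) : Term := sum v (indicator e)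

variable {c e x y : Term} {v : ℕ}

theorem eval_indicator : (indicator e).eval R T ρ = if Holds R T ρ e then 1 else 0 := rfl

@[simp] theorem holds_not : Holds R T ρ (not e) ↔ ¬ Holds R T ρ e := by
  simp [Holds, not, eval]

@[simp] theorem holds_and : Holds R T ρ (and x y) ↔ Holds R T ρ x ∧ Holds R T ρ y := by
  simp [Holds, and, eval]

@[simp] theorem holds_or : Holds R T ρ (or x y) ↔ Holds R T ρ x ∨ Holds R T ρ y := by
  by_cases hx : x.eval R T ρ = 0 <;> simp [Holds, or, eval, hx]

@[simp] theorem holds_lt : Holds R T ρ (op .lt x y) ↔ x.eval R T ρ < y.eval R T ρ := by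
  simp [Holds, eval, BinOp.eval]

@[simp] theorem holds_eq : Holds R T ρ (op .eq x y) ↔ x.eval R T ρ = y.eval R T ρ := by
  simp [Holds, eval, BinOp.eval]

theorem eval_sum_indicator : (sum v (indicator e)).eval R T ρ =
    ((List.range R).filter fun j : ℕ => Holds R T (Function.update ρ v j) e).length := by
  simp only [eval, eval_indicator, Finset.sum_boole]
  rw [← List.toFinset_card_of_nodup (List.nodup_range.filter _), List.toFinset_filter,
    List.toFinset_range]
  simp

@[simp] theorem holds_any :
    Holds R T ρ (any v e) ↔ ∃ j < R, Holds R T (Function.update ρ v j) e := by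
  have heval : (any v e).eval R T ρ = _ := eval_sum_indicator
  simp [Holds.eq_def R, heval]

end Term

namespace Cmd

/-- Computes the entries `0, …, R - 1` of the table `t`; the term `e` for the entry with the
address `var 0` may use the preceding entries. -/
def fill (t : ℕ) (e : Term) : Cmd := loop 0 (store t (.var 0) e)

theorem run_fill {t : ℕ} {e : Term} {τ : State} {V : ℕ → ℤ → Prop}
    (hV : ∀ (μ : ℕ → ℤ → ℤ) (i : ℕ), i < R → (∀ t' ≠ t, μ t' = τ.mem t') →
      (∀ j < i, V j (μ t j)) → V i (e.eval R μ (Function.update ρ 0 i))) :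
    ((fill t e).run R ρ τ).out = τ.out ∧
      (∀ t' ≠ t, ((fill t e).run R ρ τ).mem t' = τ.mem t') ∧
      ∀ i < R, V i (((fill t e).run R ρ τ).mem t i) := by
  let υ (j : ℕ) : State := (List.range j).foldl
    (fun υ (i : ℕ) => (store t (.var 0) e).run R (Function.update ρ 0 i) υ) τ
  suffices H : ∀ j ≤ R, (υ j).out = τ.out ∧ (∀ t' ≠ t, (υ j).mem t' = τ.mem t') ∧
      ∀ i < j, V i ((υ j).mem t i) from H R le_rfl
  intro j hj
  induction j with
  | zero => exact ⟨rfl, fun _ _ => rfl, fun _ hi => absurd hi (Nat.not_lt_zero _)⟩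
  | succ j ih =>
    obtain ⟨hout, hother, hval⟩ := ih (Nat.le_of_succ_le hj)
    have hstep : υ (j + 1) =
        (υ j).write t j (e.eval R (υ j).mem (Function.update ρ 0 j)) := by
      simp only [υ, List.range_succ, List.foldl_append, List.foldl_cons, List.foldl_nil]
      rw [run, Term.eval, Function.update_self]
    rw [hstep]
    refine ⟨hout, fun t' ht => ?_, fun i hi => ?_⟩
    · simp only [State.write, Function.update_of_ne ht, hother t' ht]
    · rcases Nat.lt_succ_iff_lt_or_eq.1 hi with hi | rfl
      · rw [State.write_mem_of_ne _ _ (.inr (by omega))]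
        exact hval i hi
      · rw [State.write_mem_self]
        exact hV _ i hj hother hval

/-- The command `c` leaves the tables `T` unchanged and appends the word `w` to the output. -/
def Outputs (R : ℕ) (T : ℕ → ℤ → ℤ) (ρ : ℕ → ℤ) (c : Cmd) (w : List ℤ) : Prop :=
  ∀ o, c.run R ρ ⟨T, o⟩ = ⟨T, o ++ w⟩

/-- The numbers below `R` which, as values of the variable `v`, satisfy the condition `p` are, in
increasing order, the numbers `r 0, r 1, …`. -/
def Lists (R : ℕ) (T : ℕ → ℤ → ℤ) (v : ℕ) (p : Term) {k : ℕ} (r : Fin k → ℕ) : Prop :=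
  ∀ ρ : ℕ → ℤ, (List.range R).filter (fun j : ℕ => p.Holds R T (Function.update ρ v j)) =
    List.ofFn r

variable {c c' : Cmd} {w w' : List ℤ} {p q e : Term} {v k l : ℕ} {r : Fin k → ℕ} {s : Fin l → ℕ}

theorem lists_of_strictMono (hr : StrictMono r)
    (hp : ∀ (ρ : ℕ → ℤ) (j : ℕ), j < R ∧ p.Holds R T (Function.update ρ v j) ↔ ∃ i, r i = j) :
    Lists R T v p r := by
  intro ρ
  refine List.Perm.eq_of_pairwise' (r := (· < ·)) (List.pairwise_lt_range.filter _)
    (List.pairwise_ofFn.2 fun i j hij => hr hij) ?_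
  refine (List.perm_ext_iff_of_nodup (List.nodup_range.filter _)
    (List.nodup_ofFn.2 hr.injective)).2 fun j => ?_
  simpa [List.mem_ofFn] using hp ρ j

theorem Lists.eval_sum (h : Lists R T v p r) (ρ : ℕ → ℤ) :
    (Term.sum v p.indicator).eval R T ρ = k := by
  rw [Term.eval_sum_indicator, h ρ, List.length_ofFn]

theorem outputs_emit (R : ℕ) (T : ℕ → ℤ → ℤ) (ρ : ℕ → ℤ) (e : Term) :
    Outputs R T ρ (emit e) [e.eval R T ρ] :=
  fun _ => rfl

theorem Outputs.seq (h : Outputs R T ρ c w) (h' : Outputs R T ρ c' w') :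
    Outputs R T ρ (seq c c') (w ++ w') := by
  intro o
  rw [run, h, h', List.append_assoc]

theorem Lists.outputs_loop_when {word : ℕ → List ℤ} (h : Lists R T v p r)
    (hc : ∀ j : ℕ, Outputs R T (Function.update ρ v j) c (word j)) :
    Outputs R T ρ (loop v (when p c)) ((List.ofFn r).flatMap word) := by
  intro o
  rw [← h ρ, run]
  induction List.range R generalizing o with
  | nil => simp
  | cons j js ih =>
    rw [List.foldl_cons, run]
    change List.foldl _ (if p.Holds R T _ then _ else _) js = _
    by_cases hj : p.Holds R T (Function.update ρ v j)
    · rw [if_pos hj, hc, ih]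
      simp [hj]
    · rw [if_neg hj, ih]
      simp [hj]

/-- Outputs the matrix of the values of `e`, with a row for each value of the variable `0` that
satisfies `p` and a column for each value of the variable `1` that satisfies `q`. -/
def emitMatrix (p q e : Term) : Cmd :=
  .seq (emit (.sum 0 p.indicator)) (.seq (emit (.sum 1 q.indicator))
    (loop 0 (when p (loop 1 (when q (emit e))))))

theorem outputs_emitMatrix (hp : Lists R T 0 p r) (hq : Lists R T 1 q s)
    {X : Matrix (Fin k) (Fin l) ℤ}
    (he : ∀ i j, e.eval R T (Function.update (Function.update ρ 0 (r i)) 1 (s j)) = X i j) :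
    Outputs R T ρ (emitMatrix p q e) (matrixWord X) := by
  have hrows := hp.outputs_loop_when (ρ := ρ) fun i =>
    hq.outputs_loop_when fun j => outputs_emit R T (Function.update (Function.update ρ 0 i) 1 j) e
  suffices hword : matrixWord X = [(Term.sum 0 p.indicator).eval R T ρ] ++
      ([(Term.sum 1 q.indicator).eval R T ρ] ++ (List.ofFn r).flatMap fun (i : ℕ) =>
        (List.ofFn s).flatMap fun (j : ℕ) =>
          [e.eval R T (Function.update (Function.update ρ 0 i) 1 j)]) from
    hword ▸ (outputs_emit R T ρ _).seq ((outputs_emit R T ρ _).seq hrows)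
  rw [hp.eval_sum, hq.eval_sum, matrixWord, List.flatMap_def, List.map_ofFn]
  simp only [List.cons_append, List.nil_append]
  congr 4
  funext i
  rw [Function.comp_apply, ← List.map_eq_flatMap, List.map_ofFn]
  exact congrArg List.ofFn (funext fun j => (he i j).symm)

end Cmd

theorem exists_equiv_strictMono {β : Type*} [Finite β] {code : β → ℕ} {R : ℕ}
    (hcode : Function.Injective code) (hlt : ∀ b, code b < R) :
    ∃ k ≤ R, ∃ e : Fin k ≃ β, StrictMono (code ∘ e) := by
  let := LinearOrder.lift' code hcode
  have := Fintype.ofFinite β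
  refine ⟨Fintype.card β, ?_, (Fintype.orderIsoFinOfCardEq β rfl).toEquiv,
    (Fintype.orderIsoFinOfCardEq β rfl).strictMono⟩
  have hinj : Function.Injective fun b => (⟨code b, hlt b⟩ : Fin R) := fun _ _ h =>
    hcode (Fin.val_eq_of_eq h)
  exact (Fintype.card_le_of_injective _ hinj).trans_eq (Fintype.card_fin R)

end Outputs

section Denotation

variable {R k : ℕ} {T : ℕ → ℤ → ℤ} {ρ : ℕ → ℤ}

namespace Term

/-- The term `e` has the value `z` whenever the variables below `k` have their values in `ρ`. The
variables from `k` on are thus free to be bound in terms built from `e`. -/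
def Denotes (R : ℕ) (T : ℕ → ℤ → ℤ) (k : ℕ) (ρ : ℕ → ℤ) (e : Term) (z : ℤ) : Prop :=
  ∀ ρ' : ℕ → ℤ, (∀ v < k, ρ' v = ρ v) → e.eval R T ρ' = z

/-- The term `e` decides the proposition `P` whenever the variables below `k` have their values in
`ρ`. -/
def Decides (R : ℕ) (T : ℕ → ℤ → ℤ) (k : ℕ) (ρ : ℕ → ℤ) (e : Term) (P : Prop) : Prop :=
  ∀ ρ' : ℕ → ℤ, (∀ v < k, ρ' v = ρ v) → (Holds R T ρ' e ↔ P)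

variable {e x y : Term} {z z' j : ℤ} {P Q : Prop} {a v : ℕ}

theorem eq_of_eq_update {ρ' : ℕ → ℤ} (h : ∀ v < k + 1, ρ' v = Function.update ρ k j v)
    (hv : v < k) : ρ' v = ρ v := by
  rw [h v (hv.trans k.lt_succ_self), Function.update_of_ne hv.ne]

theorem Denotes.push (h : Denotes R T k ρ e z) :
    Denotes R T (k + 1) (Function.update ρ k j) e z :=
  fun ρ' hρ => h ρ' fun _ => eq_of_eq_update hρ

theorem Decides.push (h : Decides R T k ρ e P) :
    Decides R T (k + 1) (Function.update ρ k j) e P :=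
  fun ρ' hρ => h ρ' fun _ => eq_of_eq_update hρ

theorem denotes_const (z : ℤ) : Denotes R T k ρ (const z) z := fun _ _ => rfl

theorem denotes_var_update : Denotes R T (k + 1) (Function.update ρ k j) (var k) j :=
  fun _ hρ => (hρ k k.lt_succ_self).trans (Function.update_self ..)

theorem Denotes.tab (hx : Denotes R T k ρ x z) : Denotes R T k ρ (tab a x) (T a z) :=
  fun ρ' hρ => congrArg (T a) (hx ρ' hρ)

theorem Denotes.add (hx : Denotes R T k ρ x z) (hy : Denotes R T k ρ y z') :
    Denotes R T k ρ (op .add x y) (z + z') :=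
  fun ρ' hρ => congrArg₂ (· + ·) (hx ρ' hρ) (hy ρ' hρ)

theorem Denotes.sub (hx : Denotes R T k ρ x z) (hy : Denotes R T k ρ y z') :
    Denotes R T k ρ (op .sub x y) (z - z') :=
  fun ρ' hρ => congrArg₂ (· - ·) (hx ρ' hρ) (hy ρ' hρ)

theorem Denotes.natSub {a b : ℕ} (hx : Denotes R T k ρ x a) (hy : Denotes R T k ρ y b)
    (hba : b ≤ a) : Denotes R T k ρ (op .sub x y) (a - b : ℕ) :=
  Nat.cast_sub (R := ℤ) hba ▸ hx.sub hy

theorem Denotes.ite_pos (he : Decides R T k ρ e P) (hP : P) (hx : Denotes R T k ρ x z) :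
    Denotes R T k ρ (ite e x y) z :=
  fun ρ' hρ => (if_pos ((he ρ' hρ).2 hP)).trans (hx ρ' hρ)

theorem Denotes.ite_neg (he : Decides R T k ρ e P) (hP : ¬ P) (hy : Denotes R T k ρ y z) :
    Denotes R T k ρ (ite e x y) z :=
  fun ρ' hρ => (if_neg (mt (he ρ' hρ).1 hP)).trans (hy ρ' hρ)

theorem Denotes.decides (h : Denotes R T k ρ e z) : Decides R T k ρ e (z ≠ 0) :=
  fun ρ' hρ => by rw [Holds, h ρ' hρ]

theorem Decides.congr (h : Decides R T k ρ e P) (hPQ : P ↔ Q) : Decides R T k ρ e Q :=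
  fun ρ' hρ => (h ρ' hρ).trans hPQ

theorem Decides.indicator [Decidable P] (h : Decides R T k ρ e P) :
    Denotes R T k ρ (indicator e) (if P then 1 else 0) :=
  fun ρ' hρ => if_congr (h ρ' hρ) rfl rfl

theorem Decides.not (h : Decides R T k ρ e P) : Decides R T k ρ (not e) (¬ P) :=
  fun ρ' hρ => holds_not.trans (not_congr (h ρ' hρ))

theorem Decides.and (hx : Decides R T k ρ x P) (hy : P → Decides R T k ρ y Q) :
    Decides R T k ρ (and x y) (P ∧ Q) :=
  fun ρ' hρ => holds_and.trans <| (and_congr_left' (hx ρ' hρ)).trans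
    (and_congr_right fun hP => hy hP ρ' hρ)

theorem Decides.exists_and {β : Type*} {P Q : β → Prop} (hx : Decides R T k ρ x (∃ b, P b))
    (hP : ∀ b b', P b → P b' → b = b') (hy : ∀ b, P b → Decides R T k ρ y (Q b)) :
    Decides R T k ρ (Term.and x y) (∃ b, P b ∧ Q b) :=
  (hx.and (Q := ∃ b, P b ∧ Q b) fun ⟨b, hb⟩ => (hy b hb).congr
    ⟨fun hQ => ⟨b, hb, hQ⟩, fun ⟨b', hb', hQ⟩ => hP b b' hb hb' ▸ hQ⟩).congr
      ⟨And.right, fun hQ => ⟨hQ.imp fun _ => And.left, hQ⟩⟩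

theorem Decides.or (hx : Decides R T k ρ x P) (hy : Decides R T k ρ y Q) :
    Decides R T k ρ (or x y) (P ∨ Q) :=
  fun ρ' hρ => holds_or.trans (or_congr (hx ρ' hρ) (hy ρ' hρ))

theorem Denotes.lt (hx : Denotes R T k ρ x z) (hy : Denotes R T k ρ y z') :
    Decides R T k ρ (op .lt x y) (z < z') :=
  fun ρ' hρ => holds_lt.trans (by rw [hx ρ' hρ, hy ρ' hρ])

theorem Denotes.eq (hx : Denotes R T k ρ x z) (hy : Denotes R T k ρ y z') :
    Decides R T k ρ (op .eq x y) (z = z') :=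
  fun ρ' hρ => holds_eq.trans (by rw [hx ρ' hρ, hy ρ' hρ])

theorem update_eq_update {ρ' : ℕ → ℤ} (h : ∀ v < k, ρ' v = ρ v) (j : ℤ) :
    ∀ v < k + 1, Function.update ρ' k j v = Function.update ρ k j v := by
  intro v hv
  rcases Nat.lt_succ_iff_lt_or_eq.1 hv with hv | rfl
  · rw [Function.update_of_ne hv.ne, Function.update_of_ne hv.ne, h v hv]
  · rw [Function.update_self, Function.update_self]

theorem Decides.any {P : ℕ → Prop}
    (h : ∀ j < R, Decides R T (k + 1) (Function.update ρ k j) e (P j)) :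
    Decides R T k ρ (any k e) (∃ j < R, P j) :=
  fun _ hρ => holds_any.trans <| exists_congr fun j => and_congr_right fun hj =>
    h j hj _ (update_eq_update hρ j)

theorem Decides.any_and {β : Type*} {code : β → ℕ} {P : β → Prop} (hcode : Function.Injective code)
    (hlt : ∀ b, code b < R)
    (hx : ∀ j < R, Decides R T (k + 1) (Function.update ρ k j) x (∃ b, code b = j))
    (hy : ∀ b, Decides R T (k + 1) (Function.update ρ k (code b)) y (P b)) :
    Decides R T k ρ (Term.any k (Term.and x y)) (∃ b, P b) := by
  refine (Decides.any (P := fun j => ∃ b, code b = j ∧ P b) fun j hj => (hx j hj).exists_and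
    (fun b b' hb hb' => hcode (hb.trans hb'.symm)) ?_).congr
      ⟨fun ⟨_, _, b, _, hP⟩ => ⟨b, hP⟩, fun ⟨b, hP⟩ => ⟨code b, hlt b, b, rfl, hP⟩⟩
  rintro b rfl
  exact hy b

theorem Denotes.sum {f : ℕ → ℤ}
    (h : ∀ j < R, Denotes R T (k + 1) (Function.update ρ k j) e (f j)) :
    Denotes R T k ρ (sum k e) (∑ j ∈ Finset.range R, f j) :=
  fun _ hρ => Finset.sum_congr rfl fun j hj => h j (Finset.mem_range.1 hj) _ (update_eq_update hρ j)

theorem Denotes.sum_ite_const_zero {β : Type*} [Fintype β] {code : β → ℕ} {f : β → ℤ}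
    (hcode : Function.Injective code) (hlt : ∀ b, code b < R)
    (hx : ∀ j < R, Decides R T (k + 1) (Function.update ρ k j) x (∃ b, code b = j))
    (hy : ∀ b, Denotes R T (k + 1) (Function.update ρ k (code b)) y (f b)) :
    Denotes R T k ρ (Term.sum k (ite x y (const 0))) (∑ b, f b) := by
  classical
  have hsum : ∑ b, f b = ∑ j ∈ Finset.range R, Function.extend code f 0 j := by
    refine Finset.sum_of_injOn code hcode.injOn (by simpa [Set.MapsTo] using hlt) (fun j _ hj => ?_)
      fun b _ => (hcode.extend_apply f 0 b).symm
    exact Function.extend_apply' _ _ _ (mt (by simp) hj)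
  rw [hsum]
  refine .sum fun j hj => ?_
  by_cases hb : ∃ b, code b = j
  · obtain ⟨b, rfl⟩ := hb
    rw [hcode.extend_apply]
    exact .ite_pos (hx _ hj) ⟨b, rfl⟩ (hy b)
  · rw [Function.extend_apply' _ _ _ hb]
    exact .ite_neg (hx j hj) hb (denotes_const 0)

end Term

end Denotation

open ArcDigraph

/-- The number with the last digit `b` and the leading digits `a` in base `A`; this encodes the pair
of `a` and `b` if `b < A`. -/
def pairCode (A a b : ℕ) : ℕ := a * A + b

/-- The address of `G.ReachWithin (E p) r u v` in the table of this relation. -/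
def withinCode (A r p u v : ℕ) : ℕ := pairCode A (pairCode A (pairCode A r p) u) v

section PairCode

variable {A a a' b b' k : ℕ}

theorem pairCode_div (hb : b < A) : pairCode A a b / A = a := by
  rw [pairCode, Nat.mul_comm, Nat.mul_add_div (Nat.zero_lt_of_lt hb), Nat.div_eq_of_lt hb, add_zero]

theorem pairCode_mod (hb : b < A) : pairCode A a b % A = b := by
  rw [pairCode, Nat.mul_comm, Nat.mul_add_mod, Nat.mod_eq_of_lt hb]

theorem le_pairCode (hb : b < A) : a ≤ pairCode A a b :=
  (Nat.le_mul_of_pos_right a (Nat.zero_lt_of_lt hb)).trans (Nat.le_add_right _ _)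

theorem pairCode_lt_pairCode (ha : a < a') (hb : b < A) : pairCode A a b < pairCode A a' b' :=
  calc a * A + b < (a + 1) * A := by rw [Nat.add_one_mul]; omega
    _ ≤ a' * A := Nat.mul_le_mul_right A ha
    _ ≤ a' * A + b' := Nat.le_add_right _ _

theorem pairCode_lt_pow (ha : a < A ^ k) (hb : b < A) : pairCode A a b < A ^ (k + 1) :=
  pairCode_lt_pairCode (b' := 0) ha hb

theorem withinCode_lt_withinCode {r r' p u u' v : ℕ} (hr : r' < r) (hp : p < A) (hu : u' < A)
    (hv : v < A) : withinCode A r' p u' v < withinCode A r p u v :=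
  pairCode_lt_pairCode (pairCode_lt_pairCode (pairCode_lt_pairCode hr hp) hu) hv

end PairCode

namespace Term

/-- The number of vertices. -/
def verts : Term := tab 0 (const 0)

/-- The number of arcs. -/
def arcs : Term := tab 0 (const 1)

/-- The source. -/
def source : Term := tab 0 (const 2)

/-- The sink. -/
def sink : Term := tab 0 (const 3)

/-- The tail of the arc `x`. -/
def tailOf (x : Term) : Term := tab 0 (op .add (const 4) x)

/-- The head of the arc `x`. -/
def headOf (x : Term) : Term := tab 0 (op .add (op .add (const 4) arcs) x)

/-- The base of the pair codes. -/
def base : Term := op .add (op .add verts arcs) (const 2)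

/-- The code of the pair of `x` and `y`. -/
def pair (x y : Term) : Term := op .add (tab 1 x) y

/-- The first component of the pair with the code `x`. -/
def fst (x : Term) : Term := tab 2 x

/-- The second component of the pair with the code `x`. -/
def snd (x : Term) : Term := op .sub x (tab 1 (fst x))

/-- The existence of an arc, as a value of the variable `v`, that satisfies `e`. -/
def anyArc (v : ℕ) (e : Term) : Term := any v (and (op .lt (var v) arcs) e)

/-- Looks up table `t` of a relation that depends on the length bound `r` and the parameter `p`. -/
def within (t : ℕ) (r p u v : Term) : Term := tab t (pair (pair (pair r p) u) v)

/-- The existence of a walk from `u` to `v`. -/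
def reaches (u v : Term) : Term := within 3 verts v u v

/-- The condition that `a` is the canonical arc towards `w`; it binds the variable `k`. -/
def canonArc (k : ℕ) (w a : Term) : Term :=
  and (reaches (headOf a) w)
    (not (anyArc k (and (op .lt (var k) a)
      (and (op .eq (tailOf (var k)) (tailOf a)) (reaches (headOf (var k)) w)))))

/-- The condition that the arc `a` lies on the canonical path from `u` to `w`; it binds the variable
`k`. -/
def onCanonPath (k : ℕ) (u w a : Term) : Term :=
  and (canonArc k w a) (within 4 verts w u (tailOf a))

end Term

section Tables

variable {n m : ℕ} {G : ArcDigraph n m} {s t : Fin n}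

/-- Table `0` holds the input word. -/
structure HasInput (G : ArcDigraph n m) (s t : Fin n) (T : ℕ → ℤ → ℤ) : Prop where
  verts : T 0 0 = n
  arcs : T 0 1 = m
  source : T 0 2 = (s : ℕ)
  sink : T 0 3 = (t : ℕ)
  tail (a : Fin m) : T 0 (4 + (a : ℕ)) = (G.tail a : ℕ)
  head (a : Fin m) : T 0 (4 + m + (a : ℕ)) = (G.head a : ℕ)

/-- In addition, table `1` holds the multiples of the base and table `2` the quotients by the base,
as far as they are needed to compute with pair codes below `R`. -/
structure HasPairs (R : ℕ) (G : ArcDigraph n m) (s t : Fin n) (T : ℕ → ℤ → ℤ) : Prop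
    extends HasInput G s t T where
  extent : (n + m + 2) ^ 4 ≤ R
  mul : ∀ a < R, T 1 a = (a * (n + m + 2) : ℕ)
  div : ∀ a < R, T 2 a = (a / (n + m + 2) : ℕ)

theorem HasPairs.lt_of_lt_pow {R a i : ℕ} {T : ℕ → ℤ → ℤ} (h : HasPairs R G s t T)
    (ha : a < (n + m + 2) ^ i) (hi : i ≤ 4) : a < R :=
  ha.trans_le ((Nat.pow_le_pow_right (by omega) hi).trans h.extent)

theorem HasPairs.arc_lt {R : ℕ} {T : ℕ → ℤ → ℤ} (h : HasPairs R G s t T) (a : Fin m) : a < R :=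
  h.lt_of_lt_pow (i := 1) (by rw [pow_one]; omega) (by norm_num)

theorem HasPairs.withinCode_lt {R r : ℕ} {T : ℕ → ℤ → ℤ} (h : HasPairs R G s t T) (hr : r ≤ n)
    (p u v : Fin n) : withinCode (n + m + 2) r p u v < R := by
  have hr : r < (n + m + 2) ^ 1 := by rw [pow_one]; omega
  exact h.lt_of_lt_pow (pairCode_lt_pow (pairCode_lt_pow (pairCode_lt_pow hr (by omega))
    (by omega)) (by omega)) le_rfl

/-- Table `i` holds the relations `G.ReachWithin (E p) r`. -/
def HasWithin (G : ArcDigraph n m) (E : Fin n → Fin m → Prop) (i : ℕ) (T : ℕ → ℤ → ℤ) : Prop :=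
  ∀ r ≤ n, ∀ p u v : Fin n, T i (withinCode (n + m + 2) r p u v) ≠ 0 ↔ G.ReachWithin (E p) r u v

/-- In addition, table `3` holds the reachability relation. -/
structure HasReach (R : ℕ) (G : ArcDigraph n m) (s t : Fin n) (T : ℕ → ℤ → ℤ) : Prop
    extends HasPairs R G s t T where
  reach : HasWithin G (fun _ _ => True) 3 T

/-- In addition, table `4` holds the reachability via canonical arcs. These are all tables used. -/
structure Prepared (R : ℕ) (G : ArcDigraph n m) (s t : Fin n) (T : ℕ → ℤ → ℤ) : Prop
    extends HasReach R G s t T where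
  canon : HasWithin G G.IsCanonArc 4 T

end Tables

namespace Term

variable {n m : ℕ} {G : ArcDigraph n m} {s t u v w : Fin n} {a' : Fin m} {R k a b r : ℕ}
  {T : ℕ → ℤ → ℤ} {ρ : ℕ → ℤ} {x y z e : Term}

theorem denotes_verts (h : HasInput G s t T) : Denotes R T k ρ verts n :=
  h.verts ▸ (denotes_const 0).tab

theorem denotes_arcs (h : HasInput G s t T) : Denotes R T k ρ arcs m :=
  h.arcs ▸ (denotes_const 1).tab

theorem denotes_source (h : HasInput G s t T) : Denotes R T k ρ source (s : ℕ) :=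
  h.source ▸ (denotes_const 2).tab

theorem denotes_sink (h : HasInput G s t T) : Denotes R T k ρ sink (t : ℕ) :=
  h.sink ▸ (denotes_const 3).tab

theorem denotes_base (h : HasInput G s t T) : Denotes R T k ρ base (n + m + 2 : ℕ) :=
  mod_cast ((denotes_verts h).add (denotes_arcs h)).add (denotes_const 2)

theorem Denotes.tailOf (hx : Denotes R T k ρ x (a' : ℕ)) (h : HasInput G s t T) :
    Denotes R T k ρ (tailOf x) (G.tail a' : ℕ) :=
  h.tail a' ▸ ((denotes_const 4).add hx).tab

theorem Denotes.headOf (hx : Denotes R T k ρ x (a' : ℕ)) (h : HasInput G s t T) :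
    Denotes R T k ρ (headOf x) (G.head a' : ℕ) :=
  h.head a' ▸ (((denotes_const 4).add (denotes_arcs h)).add hx).tab

theorem Denotes.pair (hx : Denotes R T k ρ x a) (hy : Denotes R T k ρ y b)
    (h : HasPairs R G s t T) (ha : a < R) :
    Denotes R T k ρ (pair x y) (pairCode (n + m + 2) a b) := by
  rw [pairCode, Nat.cast_add, ← h.mul a ha]
  exact hx.tab.add hy

theorem Denotes.fst (hx : Denotes R T k ρ x a) (h : HasPairs R G s t T) (ha : a < R) :
    Denotes R T k ρ (fst x) (a / (n + m + 2) : ℕ) :=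
  h.div a ha ▸ hx.tab

theorem Denotes.snd (hx : Denotes R T k ρ x a) (h : HasPairs R G s t T) (ha : a < R) :
    Denotes R T k ρ (snd x) (a % (n + m + 2) : ℕ) := by
  have hval : ((a % (n + m + 2) : ℕ) : ℤ) = a - T 1 (a / (n + m + 2) : ℕ) := by
    rw [h.mul _ ((Nat.div_le_self ..).trans_lt ha), eq_sub_iff_add_eq', ← Nat.cast_add,
      Nat.div_add_mod']
  rw [hval]
  exact hx.sub (hx.fst h ha).tab

theorem Denotes.fst_of_pairCode (hx : Denotes R T k ρ x (pairCode (n + m + 2) a b))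
    (h : HasPairs R G s t T) (hb : b < n + m + 2) (hlt : pairCode (n + m + 2) a b < R) :
    Denotes R T k ρ (Term.fst x) a := by
  simpa only [pairCode_div hb] using hx.fst h hlt

theorem Denotes.snd_of_pairCode (hx : Denotes R T k ρ x (pairCode (n + m + 2) a b))
    (h : HasPairs R G s t T) (hb : b < n + m + 2) (hlt : pairCode (n + m + 2) a b < R) :
    Denotes R T k ρ (Term.snd x) b := by
  simpa only [pairCode_mod hb] using hx.snd h hlt

theorem Denotes.eq_fin (hx : Denotes R T k ρ x (u : ℕ)) (hy : Denotes R T k ρ y (v : ℕ)) :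
    Decides R T k ρ (op .eq x y) (u = v) :=
  (hx.eq hy).congr (Nat.cast_inj.trans Fin.val_inj)

theorem Denotes.lt_fin (hx : Denotes R T k ρ x (u : ℕ)) (hy : Denotes R T k ρ y (v : ℕ)) :
    Decides R T k ρ (op .lt x y) (u < v) :=
  (hx.lt hy).congr (Nat.cast_lt.trans Fin.val_fin_lt)

theorem Denotes.lt_arcs (hx : Denotes R T k ρ x a) (h : HasInput G s t T) :
    Decides R T k ρ (op .lt x arcs) (∃ b : Fin m, (b : ℕ) = a) :=
  (hx.lt (denotes_arcs h)).congr <|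
    Nat.cast_lt.trans ⟨fun ha => ⟨⟨a, ha⟩, rfl⟩, fun ⟨b, hb⟩ => hb ▸ b.2⟩

theorem Decides.anyArc {P : Fin m → Prop} (h : HasPairs R G s t T)
    (he : ∀ a : Fin m, Decides R T (k + 1) (Function.update ρ k (a : ℕ)) e (P a)) :
    Decides R T k ρ (anyArc k e) (∃ a, P a) :=
  .any_and Fin.val_injective h.arc_lt (fun _ _ => denotes_var_update.lt_arcs h.toHasInput) he

theorem Denotes.within {i : ℕ} {xr xp xu xv : Term} (hr : Denotes R T k ρ xr r)
    (hw : Denotes R T k ρ xp (w : ℕ)) (hu : Denotes R T k ρ xu (u : ℕ))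
    (hv : Denotes R T k ρ xv (v : ℕ)) (h : HasPairs R G s t T) (hrn : r ≤ n) :
    Denotes R T k ρ (within i xr xp xu xv) (T i (withinCode (n + m + 2) r w u v)) := by
  have hlt := h.withinCode_lt hrn w u v
  have hlt₂ := (le_pairCode (by omega)).trans_lt hlt
  have hlt₁ := (le_pairCode (by omega)).trans_lt hlt₂
  exact (((hr.pair hw h ((le_pairCode (by omega)).trans_lt hlt₁)).pair hu h hlt₁).pair hv h
    hlt₂).tab

theorem Decides.within {E : Fin n → Fin m → Prop} {i : ℕ} {xr xp xu xv : Term}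
    (hr : Denotes R T k ρ xr r) (hw : Denotes R T k ρ xp (w : ℕ)) (hu : Denotes R T k ρ xu (u : ℕ))
    (hv : Denotes R T k ρ xv (v : ℕ)) (h : HasPairs R G s t T) (hE : HasWithin G E i T)
    (hrn : r ≤ n) : Decides R T k ρ (within i xr xp xu xv) (G.ReachWithin (E w) r u v) :=
  (Denotes.within hr hw hu hv h hrn).decides.congr (hE r hrn w u v)

theorem Decides.reaches (hG : G.Acyclic) (h : HasReach R G s t T) (hx : Denotes R T k ρ x (u : ℕ))
    (hy : Denotes R T k ρ y (v : ℕ)) : Decides R T k ρ (reaches x y) (G.Reach u v) :=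
  (Decides.within (denotes_verts h.toHasInput) hy hx hy h.toHasPairs h.reach le_rfl).congr
    (hG.reachWithin_card.trans reachVia_true)

theorem Decides.canonArc (hG : G.Acyclic) (h : HasReach R G s t T)
    (hx : Denotes R T k ρ x (w : ℕ)) (hy : Denotes R T k ρ y (a' : ℕ)) :
    Decides R T k ρ (canonArc k x y) (G.IsCanonArc w a') := by
  have hin := h.toHasInput
  have hnone : Decides R T k ρ _ (¬ ∃ b < a', G.tail b = G.tail a' ∧ G.Reach (G.head b) w) :=
    (Decides.anyArc h.toHasPairs fun b => (denotes_var_update.lt_fin hy.push).and fun _ =>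
      ((denotes_var_update.tailOf hin).eq_fin (hy.push.tailOf hin)).and fun _ =>
        .reaches hG h (denotes_var_update.headOf hin) hx.push).not
  refine ((Decides.reaches hG h (hy.headOf hin) hx).and fun _ => hnone).congr ?_
  simp only [IsCanonArc, not_exists, not_and]

theorem Decides.onCanonPath (hG : G.Acyclic) (h : Prepared R G s t T)
    (hx : Denotes R T k ρ x (u : ℕ)) (hy : Denotes R T k ρ y (w : ℕ))
    (hz : Denotes R T k ρ z (a' : ℕ)) (huw : G.Reach u w) :
    Decides R T k ρ (onCanonPath k x y z) (a' ∈ G.canonPath u w) :=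
  ((Decides.canonArc hG h.toHasReach hy hz).and fun _ =>
    .within (denotes_verts h.toHasInput) hy hx (hz.tailOf h.toHasInput) h.toHasPairs h.canon
      le_rfl).congr ((and_congr_right fun _ => hG.reachWithin_card).trans
        (hG.mem_canonPath huw).symm)

end Term

section Preparation

variable {n m : ℕ} {G : ArcDigraph n m} {s t u v : Fin n} {R a r : ℕ}
  {T T' : ℕ → ℤ → ℤ} {ρ : ℕ → ℤ} {e : Term} {τ : State}

theorem hasInput_initial (G : ArcDigraph n m) (s t : Fin n) :
    HasInput G s t (initial (G.inputWord s t)).mem := by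
  have hmem : ∀ i : ℕ, (initial (G.inputWord s t)).mem 0 i = (G.inputWord s t).getD i 0 :=
    fun i => by simp [initial]
  refine ⟨hmem 0, hmem 1, hmem 2, hmem 3, fun a => ?_, fun a => ?_⟩
  · have htail : (G.inputWord s t).getD (4 + a) 0 = (G.tail a : ℕ) := by
      simp [inputWord, add_comm 4, List.getElem?_append]
    exact_mod_cast (hmem (4 + a)).trans htail
  · have hhead : (G.inputWord s t).getD (4 + m + a) 0 = (G.head a : ℕ) := by
      simp [inputWord, add_comm 4, add_right_comm _ 4]
    exact_mod_cast (hmem (4 + m + a)).trans hhead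

theorem HasInput.congr (h : HasInput G s t T) (h0 : T' 0 = T 0) : HasInput G s t T' :=
  ⟨h0 ▸ h.verts, h0 ▸ h.arcs, h0 ▸ h.source, h0 ▸ h.sink, h0 ▸ h.tail, h0 ▸ h.head⟩

theorem HasPairs.congr (h : HasPairs R G s t T) (hT : ∀ i < 3, T' i = T i) :
    HasPairs R G s t T' :=
  ⟨h.toHasInput.congr (hT 0 (by norm_num)), h.extent, hT 1 (by norm_num) ▸ h.mul,
    hT 2 (by norm_num) ▸ h.div⟩

theorem HasReach.congr (h : HasReach R G s t T) (hT : ∀ i < 4, T' i = T i) :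
    HasReach R G s t T' :=
  ⟨h.toHasPairs.congr fun i hi => hT i (by omega), by
    simpa only [HasWithin, hT 3 (by norm_num)] using h.reach⟩

namespace Term

/-- The entry `var 0` of table `1`. -/
def mulEntry : Term :=
  ite (var 0) (op .add (tab 1 (op .sub (var 0) (const 1))) base) (const 0)

/-- The entry `var 0` of table `2`. -/
def divEntry : Term :=
  ite (op .lt (var 0) base) (const 0) (op .add (tab 2 (op .sub (var 0) base)) (const 1))

/-- The parameter `p` in the entry `var 0` of a table of relations `G.ReachWithin (E p) r`. -/
def param : Term := snd (fst (fst (var 0)))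

/-- The entry `var 0` of table `t` of the relations `G.ReachWithin (E p) r`, if `e` decides `E p`
for the arc `var 1`. -/
def withinEntry (t : ℕ) (e : Term) : Term :=
  let p := fst (fst (var 0))
  or (op .eq (snd (fst (var 0))) (snd (var 0)))
    (and (fst p) (anyArc 1 (and (op .eq (tailOf (var 1)) (snd (fst (var 0))))
      (and e (within t (op .sub (fst p) (const 1)) param (headOf (var 1)) (snd (var 0)))))))

theorem Denotes.mulEntry (ha : Denotes R T 1 ρ (var 0) a) (h : HasInput G s t T)
    (hlt : ∀ j < a, T 1 j = (j * (n + m + 2) : ℕ)) :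
    Denotes R T 1 ρ mulEntry (a * (n + m + 2) : ℕ) := by
  rcases a with _ | a
  · rw [Nat.zero_mul]
    exact .ite_neg ha.decides (by simp) (denotes_const 0)
  · refine .ite_pos ha.decides (by norm_cast) ?_
    rw [Nat.add_one_mul, Nat.cast_add (a * _), ← hlt a a.lt_succ_self]
    exact (ha.natSub (b := 1) (denotes_const 1) (by omega)).tab.add (denotes_base h)

theorem Denotes.divEntry (ha : Denotes R T 1 ρ (var 0) a) (h : HasInput G s t T)
    (hlt : ∀ j < a, T 2 j = (j / (n + m + 2) : ℕ)) :
    Denotes R T 1 ρ divEntry (a / (n + m + 2) : ℕ) := by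
  have hcond := (ha.lt (denotes_base h)).congr Nat.cast_lt
  rcases lt_or_ge a (n + m + 2) with hlt' | hge
  · rw [Nat.div_eq_of_lt hlt']
    exact .ite_pos hcond hlt' (denotes_const 0)
  · refine .ite_neg hcond hge.not_gt ?_
    rw [Nat.div_eq_sub_div (by omega) hge, Nat.cast_add, ← hlt (a - (n + m + 2)) (by omega)]
    exact (ha.natSub (denotes_base h) hge).tab.add (denotes_const 1)

theorem Decides.withinEntry {i : ℕ} {p : Fin n} {E : Fin m → Prop}
    (h₃ : Denotes R T 1 ρ (var 0) (withinCode (n + m + 2) r p u v)) (h : HasPairs R G s t T)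
    (hr : r ≤ n)
    (he : ∀ (ρ : ℕ → ℤ) (a : Fin m), Denotes R T 2 ρ param (p : ℕ) →
      Denotes R T 2 ρ (var 1) (a : ℕ) → Decides R T 2 ρ e (E a))
    (hlt : ∀ r' ≤ n, r' < r → ∀ u' : Fin n,
      T i (withinCode (n + m + 2) r' p u' v) ≠ 0 ↔ G.ReachWithin E r' u' v) :
    Decides R T 1 ρ (withinEntry i e) (G.ReachWithin E r u v) := by
  have hlt₃ := h.withinCode_lt hr p u v
  have hlt₂ := (le_pairCode (by omega)).trans_lt hlt₃
  have hlt₁ := (le_pairCode (by omega)).trans_lt hlt₂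
  have h₂ := h₃.fst_of_pairCode h (by omega) hlt₃
  have h₁ := h₂.fst_of_pairCode h (by omega) hlt₂
  have hxr := h₁.fst_of_pairCode h (by omega) hlt₁
  have hxp : Denotes R T 1 _ param (p : ℕ) := h₁.snd_of_pairCode h (by omega) hlt₁
  have hxu := h₂.snd_of_pairCode h (by omega) hlt₂
  have hxv := h₃.snd_of_pairCode h (by omega) hlt₃
  rw [reachWithin_iff]
  refine (hxu.eq_fin hxv).or ((hxr.decides.congr Nat.cast_ne_zero).and fun hr0 =>
    .anyArc h fun a => ?_)
  have hxa : Denotes R T 2 (Function.update ρ 1 (a : ℕ)) (var 1) (a : ℕ) := denotes_var_update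
  exact ((hxa.tailOf h.toHasInput).eq_fin hxu.push).and fun _ => (he _ a hxp.push hxa).and fun _ =>
    (Denotes.within (hxr.push.natSub (b := 1) (denotes_const 1) (by omega)) hxp.push
      (hxa.headOf h.toHasInput) hxv.push h (by omega)).decides.congr
      (hlt (r - 1) (by omega) (by omega) _)

end Term

namespace Cmd

theorem hasPairs_run_fill (h : HasInput G s t τ.mem) (hR : (n + m + 2) ^ 4 ≤ R) :
    ((seq (fill 1 .mulEntry) (fill 2 .divEntry)).run R ρ τ).out = τ.out ∧
      HasPairs R G s t ((seq (fill 1 .mulEntry) (fill 2 .divEntry)).run R ρ τ).mem := by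
  obtain ⟨hout₁, hmem₁, hmul⟩ := run_fill (R := R) (ρ := ρ) (t := 1) (e := .mulEntry) (τ := τ)
    (V := fun i z => z = (i * (n + m + 2) : ℕ)) fun T i _ hT hlt =>
      Term.denotes_var_update.mulEntry (h.congr (hT 0 (by norm_num))) hlt _ fun _ _ => rfl
  obtain ⟨hout₂, hmem₂, hdiv⟩ := run_fill (R := R) (ρ := ρ) (t := 2) (e := .divEntry)
    (τ := (fill 1 .mulEntry).run R ρ τ) (V := fun i z => z = (i / (n + m + 2) : ℕ))
    fun T i _ hT hlt => Term.denotes_var_update.divEntry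
      (h.congr ((hT 0 (by norm_num)).trans (hmem₁ 0 (by norm_num)))) hlt _ fun _ _ => rfl
  exact ⟨hout₂.trans hout₁,
    h.congr ((hmem₂ 0 (by norm_num)).trans (hmem₁ 0 (by norm_num))), hR,
    fun a ha => (congrFun (hmem₂ 1 (by norm_num)) _).trans (hmul a ha), hdiv⟩

theorem hasWithin_run_fill {i : ℕ} (hi : 3 ≤ i) (h : HasPairs R G s t τ.mem)
    {E : Fin n → Fin m → Prop}
    (he : ∀ (T : ℕ → ℤ → ℤ) (ρ : ℕ → ℤ) (p : Fin n) (a : Fin m), (∀ j ≠ i, T j = τ.mem j) →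
      Term.Denotes R T 2 ρ .param (p : ℕ) → Term.Denotes R T 2 ρ (.var 1) (a : ℕ) →
      Term.Decides R T 2 ρ e (E p a)) :
    ((fill i (.withinEntry i e)).run R ρ τ).out = τ.out ∧
      (∀ j ≠ i, ((fill i (.withinEntry i e)).run R ρ τ).mem j = τ.mem j) ∧
      HasWithin G E i ((fill i (.withinEntry i e)).run R ρ τ).mem := by
  have hfill := run_fill (R := R) (ρ := ρ) (t := i) (e := .withinEntry i e) (τ := τ)
    (V := fun c z => ∀ r ≤ n, ∀ p u v : Fin n, withinCode (n + m + 2) r p u v = c →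
      (z ≠ 0 ↔ G.ReachWithin (E p) r u v))
  obtain ⟨hout, hmem, hval⟩ := hfill <| by
    rintro T _ - hT hlt r hr p u v rfl
    exact Term.Decides.withinEntry Term.denotes_var_update (h.congr fun j hj => hT j (by omega)) hr
      (fun ρ a hp ha => he T ρ p a hT hp ha)
      (fun r' hr' hr'r u' => hlt _ (withinCode_lt_withinCode hr'r (by omega) (by omega) (by omega))
        r' hr' p u' v rfl) _ fun _ _ => rfl
  exact ⟨hout, hmem, fun r hr p u v => hval _ (h.withinCode_lt hr p u v) r hr p u v rfl⟩

/-- Computes all tables. -/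
def prepare : Cmd :=
  seq (seq (fill 1 .mulEntry) (fill 2 .divEntry))
    (seq (fill 3 (.withinEntry 3 (.const 1)))
      (fill 4 (.withinEntry 4 (.canonArc 2 .param (.var 1)))))

theorem prepared_run_prepare (hG : G.Acyclic) (h : HasInput G s t τ.mem)
    (hR : (n + m + 2) ^ 4 ≤ R) :
    (prepare.run R ρ τ).out = τ.out ∧ Prepared R G s t (prepare.run R ρ τ).mem := by
  obtain ⟨hout₂, h₂⟩ := hasPairs_run_fill (ρ := ρ) h hR
  obtain ⟨hout₃, hmem₃, hreach⟩ := hasWithin_run_fill (ρ := ρ) (i := 3) (e := .const 1)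
    (E := fun _ _ => True) le_rfl h₂ fun T ρ p a _ _ _ =>
      (Term.denotes_const 1).decides.congr (by simp)
  have h₃ : HasReach R G s t _ := ⟨h₂.congr fun i hi => hmem₃ i (by omega), hreach⟩
  obtain ⟨hout₄, hmem₄, hcanon⟩ := hasWithin_run_fill (ρ := ρ) (i := 4) (E := G.IsCanonArc)
    (by norm_num) h₃.toHasPairs fun T ρ p a hT hp ha =>
      .canonArc hG (h₃.congr fun i hi => hT i (by omega)) hp ha
  exact ⟨hout₄.trans (hout₃.trans hout₂), h₃.congr fun i hi => hmem₄ i (by omega), hcanon⟩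

end Cmd

end Preparation

section ArcLists

/-- The list `L` of arcs as a number with the digits `a + 1` for `a ∈ L` in base `A`; the first arc
is the last digit. No digit is `0`, hence different lists have different codes. -/
def listCode (A : ℕ) {m : ℕ} : List (Fin m) → ℕ
  | [] => 0
  | a :: L => pairCode A (listCode A L) (a + 1)

/-- A set of arcs is encoded as the list of its elements in decreasing order. -/
def setCode (A : ℕ) {m : ℕ} (B : Finset (Fin m)) : ℕ := listCode A (B.sort (· ≥ ·))

section ListCode

variable {A m d j : ℕ} {a : Fin m} {L : List (Fin m)}

theorem listCode_ne_zero : listCode A L ≠ 0 ↔ L ≠ [] := by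
  cases L <;> simp [listCode, pairCode]

theorem listCode_cons_eq_iff (hA : m < A) :
    listCode A (a :: L) = j ↔ j % A = a + 1 ∧ listCode A L = j / A := by
  have ha : (a : ℕ) + 1 < A := by omega
  constructor
  · rintro rfl
    exact ⟨pairCode_mod ha, (pairCode_div ha).symm⟩
  · rintro ⟨hmod, hdiv⟩
    rw [listCode, pairCode, hdiv, ← hmod, Nat.div_add_mod']

theorem listCode_injective (hA : m < A) : Function.Injective (listCode A (m := m)) := by
  intro L L' h
  induction L generalizing L' with
  | nil => exact (not_ne_iff.1 (mt listCode_ne_zero.2 (not_ne_iff.2 h.symm))).symm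
  | cons a L ih =>
    rcases L' with _ | ⟨a', L'⟩
    · exact absurd h (listCode_ne_zero.2 (List.cons_ne_nil a L))
    · obtain ⟨hmod, hdiv⟩ := (listCode_cons_eq_iff hA).1 h
      obtain ⟨hmod', hdiv'⟩ := (listCode_cons_eq_iff (a := a') (L := L') hA).1 rfl
      rw [ih (hdiv.trans hdiv'.symm), Fin.ext (Nat.succ_injective (hmod.symm.trans hmod'))]

theorem listCode_lt_pow (hA : m < A) (hL : L.length ≤ d) : listCode A L < A ^ d := by
  induction L generalizing d with
  | nil => exact Nat.pow_pos (by omega)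
  | cons a L ih =>
    obtain ⟨d, rfl⟩ := Nat.exists_eq_add_of_le' ((Nat.le_add_left 1 _).trans hL)
    exact pairCode_lt_pow (ih (Nat.le_of_succ_le_succ hL)) (by omega)

theorem setCode_injective (hA : m < A) : Function.Injective (setCode A (m := m)) :=
  fun B B' h => by
    rw [← B.sort_toFinset (· ≥ ·), listCode_injective hA h, Finset.sort_toFinset]

theorem setCode_lt_pow (hA : m < A) (B : ArcSubset m d) : setCode A B.1 < A ^ d :=
  listCode_lt_pow hA ((Finset.length_sort _).trans_le B.2)

end ListCode

namespace Term

/-- The first arc of the list with the code `x`. -/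
def headArc (x : Term) : Term := op .sub (snd x) (const 1)

/-- The condition that the last digit of `x` encodes an arc. -/
def hasHeadArc (x : Term) : Term := and (snd x) (op .lt (headArc x) arcs)

/-- The condition that the arc `z` belongs to the list with the code `x` and of a length of at most
`f`. -/
def elem : ℕ → Term → Term → Term
  | 0, _, _ => const 0
  | f + 1, z, x => and x (or (op .eq z (headArc x)) (elem f z (fst x)))

/-- The condition that the lists with the codes `x` and `y` and of a length of at most `f` have the
same elements; it binds the variable `k`. -/
def sameElems (k f : ℕ) (x y : Term) : Term :=
  not (anyArc k (not (op .eq (indicator (elem f (var k) x)) (indicator (elem f (var k) y)))))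

/-- The condition that `x` is the code of a list of a length of at most `f` that is accepted from
the state `w` by an automaton: `step w a` decides whether it may read the arc `a` in the state `w`,
this leads to the state `next a`, and `final w` decides whether it accepts in the state `w`. -/
def accepts (final : Term → Term) (step : Term → Term → Term) (next : Term → Term) :
    ℕ → Term → Term → Term
  | 0, x, w => and (not x) (final w)
  | f + 1, x, w => or (and (not x) (final w))
      (and (hasHeadArc x)
        (and (step w (headArc x)) (accepts final step next f (fst x) (next (headArc x)))))

/-- The condition that `x` is the code of a set of at most `d` arcs. -/
def isSet (d : ℕ) (x : Term) : Term :=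
  accepts (fun _ => const 1) (fun w a => op .lt a w) id d x arcs

/-- The condition that `x` is the code of a deviation of at most `d` arcs; it binds the variable
`k`. -/
def isDeviation (k d : ℕ) (x : Term) : Term :=
  accepts (reaches source) (fun w a => and (reaches (headOf a) w) (not (canonArc k w a))) tailOf
    d x sink

variable {n m : ℕ} {G : ArcDigraph n m} {s t : Fin n} {a : Fin m} {R k d f j : ℕ}
  {T : ℕ → ℤ → ℤ} {ρ : ℕ → ℤ} {x y z : Term} {D L : List (Fin m)}

theorem Decides.iff {P Q : Prop} (hx : Decides R T k ρ x P) (hy : Decides R T k ρ y Q) :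
    Decides R T k ρ (op .eq (Term.indicator x) (Term.indicator y)) (P ↔ Q) := by
  classical
  refine (hx.indicator.eq hy.indicator).congr ?_
  by_cases hP : P <;> by_cases hQ : Q <;> simp [hP, hQ]

theorem Denotes.headArc (hx : Denotes R T k ρ x j) (h : HasPairs R G s t T) (hj : j < R)
    (ha : j % (n + m + 2) = a + 1) : Denotes R T k ρ (headArc x) (a : ℕ) := by
  have hsub := (hx.snd h hj).natSub (b := 1) (denotes_const 1) (by omega)
  rwa [ha, Nat.add_sub_cancel] at hsub

theorem Denotes.isCons (hx : Denotes R T k ρ x (listCode (n + m + 2) L)) :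
    Decides R T k ρ x (L ≠ []) :=
  hx.decides.congr (Nat.cast_ne_zero.trans listCode_ne_zero)

theorem Denotes.headArc_of_cons (hx : Denotes R T k ρ x (listCode (n + m + 2) (a :: L)))
    (h : HasPairs R G s t T) (hlt : listCode (n + m + 2) (a :: L) < R) :
    Denotes R T k ρ (Term.headArc x) (a : ℕ) :=
  hx.headArc h hlt (pairCode_mod (by omega))

theorem Denotes.fst_of_cons (hx : Denotes R T k ρ x (listCode (n + m + 2) (a :: L)))
    (h : HasPairs R G s t T) (hlt : listCode (n + m + 2) (a :: L) < R) :
    Denotes R T k ρ (Term.fst x) (listCode (n + m + 2) L) :=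
  hx.fst_of_pairCode h (by omega) hlt

theorem listCode_lt_of_cons (hlt : listCode (n + m + 2) (a :: L) < R) :
    listCode (n + m + 2) L < R :=
  (le_pairCode (by omega)).trans_lt hlt

theorem Decides.elem (hz : Denotes R T k ρ z (a : ℕ))
    (hx : Denotes R T k ρ x (listCode (n + m + 2) L)) (h : HasPairs R G s t T)
    (hlt : listCode (n + m + 2) L < R) (hf : L.length ≤ f) :
    Decides R T k ρ (elem f z x) (a ∈ L) := by
  induction f generalizing L x with
  | zero =>
    obtain rfl := List.length_eq_zero_iff.1 (Nat.le_zero.1 hf)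
    exact (denotes_const 0).decides.congr (by simp)
  | succ f ih =>
    rcases L with _ | ⟨b, L⟩
    · exact (hx.isCons.and (Q := False) fun hL => absurd rfl hL).congr (by simp)
    · refine (hx.isCons.and fun _ => (hz.eq_fin (hx.headArc_of_cons h hlt)).or
        (ih (hx.fst_of_cons h hlt) (listCode_lt_of_cons hlt) (Nat.le_of_succ_le_succ hf))).congr ?_
      simp

theorem Decides.sameElems (hx : Denotes R T k ρ x (listCode (n + m + 2) L))
    (hy : Denotes R T k ρ y (listCode (n + m + 2) D)) (h : HasPairs R G s t T)
    (hL : listCode (n + m + 2) L < R) (hD : listCode (n + m + 2) D < R) (hLf : L.length ≤ f)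
    (hDf : D.length ≤ f) : Decides R T k ρ (sameElems k f x y) (∀ a, a ∈ L ↔ a ∈ D) :=
  (Decides.anyArc h fun _ => ((Decides.elem denotes_var_update hx.push h hL hLf).iff
    (.elem denotes_var_update hy.push h hD hDf)).not).not.congr not_exists_not

theorem Decides.hasHeadArc (hx : Denotes R T k ρ x j) (h : HasPairs R G s t T) (hj : j < R) :
    Decides R T k ρ (hasHeadArc x) (∃ a : Fin m, j % (n + m + 2) = a + 1) := by
  refine (((hx.snd h hj).decides.congr Nat.cast_ne_zero).and fun _ =>
    ((hx.snd h hj).natSub (b := 1) (denotes_const 1) (by omega)).lt_arcs h.toHasInput).congr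
      ⟨fun ⟨_, a, ha⟩ => ⟨a, by omega⟩, fun ⟨a, ha⟩ => ⟨by omega, a, by omega⟩⟩

theorem Decides.accepts {σ : Type*} {val : σ → ℕ} {Φ : List (Fin m) → σ → Prop}
    {P : σ → Fin m → Prop} {nxt : Fin m → σ} {final next : Term → Term}
    {step : Term → Term → Term} {c : σ}
    (hΦ : ∀ a L c, Φ (a :: L) c ↔ P c a ∧ Φ L (nxt a))
    (hfinal : ∀ y c, Denotes R T k ρ y (val c) → Decides R T k ρ (final y) (Φ [] c))
    (hstep : ∀ y z c (a : Fin m), Denotes R T k ρ y (val c) → Denotes R T k ρ z (a : ℕ) →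
      Decides R T k ρ (step y z) (P c a))
    (hnext : ∀ z (a : Fin m), Denotes R T k ρ z (a : ℕ) → Denotes R T k ρ (next z) (val (nxt a)))
    (h : HasPairs R G s t T) (hx : Denotes R T k ρ x j) (hj : j < R)
    (hy : Denotes R T k ρ y (val c)) :
    Decides R T k ρ (accepts final step next f x y)
      (∃ L, L.length ≤ f ∧ listCode (n + m + 2) L = j ∧ Φ L c) := by
  have hnil (x y j c) (hx : Denotes R T k ρ x (j : ℕ)) (hy : Denotes R T k ρ y (val c)) :
      Decides R T k ρ (Term.and (Term.not x) (final y)) (j = 0 ∧ Φ [] c) :=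
    (hx.decides.not.congr (by simp)).and fun _ => hfinal y c hy
  induction f generalizing x y j c with
  | zero =>
    refine (hnil x y j c hx hy).congr ⟨fun ⟨hj, hc⟩ => ⟨[], le_rfl, hj.symm, hc⟩, ?_⟩
    rintro ⟨L, hL, hcode, hc⟩
    rw [List.length_eq_zero_iff.1 (Nat.le_zero.1 hL)] at hcode hc
    exact ⟨hcode.symm, hc⟩
  | succ f ih =>
    refine ((hnil x y j c hx hy).or ((Decides.hasHeadArc hx h hj).exists_and
      (Q := fun a => P c a ∧ ∃ L, L.length ≤ f ∧ listCode (n + m + 2) L = j / (n + m + 2) ∧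
        Φ L (nxt a))
      (fun a b ha hb => Fin.ext (Nat.succ_injective (ha.symm.trans hb))) fun a ha => ?_)).congr
        ⟨?_, ?_⟩
    · have hza := hx.headArc h hj ha
      exact (hstep _ _ c a hy hza).and fun _ => ih (hx.fst h hj) ((Nat.div_le_self ..).trans_lt hj)
        (hnext _ a hza)
    · rintro (⟨rfl, hc⟩ | ⟨a, ha, hP, L, hL, hcode, hc⟩)
      · exact ⟨[], Nat.zero_le _, rfl, hc⟩
      · exact ⟨a :: L, Nat.succ_le_succ hL, (listCode_cons_eq_iff (by omega)).2 ⟨ha, hcode⟩,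
          (hΦ a L c).2 ⟨hP, hc⟩⟩
    · rintro ⟨_ | ⟨a, L⟩, hL, hcode, hc⟩
      · exact .inl ⟨hcode.symm, hc⟩
      · obtain ⟨ha, hdiv⟩ := (listCode_cons_eq_iff (by omega)).1 hcode
        obtain ⟨hP, hc⟩ := (hΦ a L c).1 hc
        exact .inr ⟨a, ha, hP, L, Nat.le_of_succ_le_succ hL, hdiv, hc⟩

theorem Decides.isDeviation (hG : G.Acyclic) (h : HasReach R G s t T) (hx : Denotes R T k ρ x j)
    (hj : j < R) : Decides R T k ρ (isDeviation k d x)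
      (∃ D, D.length ≤ d ∧ listCode (n + m + 2) D = j ∧ G.IsDeviation s D t) :=
  have hin := h.toHasInput
  Decides.accepts (val := Fin.val) (P := fun w a => G.Reach (G.head a) w ∧ ¬ G.IsCanonArc w a)
    (fun _ _ _ => and_assoc.symm) (fun _ _ hw => .reaches hG h (denotes_source hin) hw)
    (fun _ _ _ _ hw ha => (Decides.reaches hG h (ha.headOf hin) hw).and fun _ =>
      (Decides.canonArc hG h hw ha).not)
    (fun _ _ ha => ha.tailOf hin) h.toHasPairs hx hj (denotes_sink hin)

theorem Decides.isSet (h : HasPairs R G s t T) (hx : Denotes R T k ρ x j) (hj : j < R) :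
    Decides R T k ρ (isSet d x) (∃ B : ArcSubset m d, setCode (n + m + 2) B.1 = j) := by
  refine (Decides.accepts (val := id) (P := fun b a => (a : ℕ) < b) (nxt := fun a => (a : ℕ))
    (Φ := fun L b => (b :: L.map Fin.val).IsChain (· > ·)) (fun _ _ _ => List.isChain_cons_cons)
    (fun _ _ _ => (denotes_const 1).decides.congr (by simp))
    (fun _ _ _ _ hb ha => (ha.lt hb).congr Nat.cast_lt) (fun _ _ ha => ha) h hx hj
    (denotes_arcs h.toHasInput)).congr ⟨?_, ?_⟩
  · rintro ⟨L, hL, rfl, hchain⟩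
    have hsorted := ((List.isChain_map _).1 hchain.tail).sortedGT
    refine ⟨⟨L.toFinset, L.toFinset_card_le.trans hL⟩, ?_⟩
    rw [setCode, (List.toFinset_sort _ hsorted.nodup).2 hsorted.sortedGE.pairwise]
  · rintro ⟨B, rfl⟩
    refine ⟨B.1.sort (· ≥ ·), (Finset.length_sort _).trans_le B.2, rfl, ?_⟩
    refine List.isChain_cons.2 ⟨fun b hb => ?_, (List.isChain_map _).2 B.1.sortedGT_sort.isChain⟩
    obtain ⟨a, -, rfl⟩ := List.mem_map.1 (List.mem_of_mem_head? hb)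
    exact a.2

end Term

end ArcLists

section MixedDifferenceTerms

namespace Term

/-- The condition that the list with the code `x` and of a length of at most `d` consists of arcs
`var k` that satisfy `e`. -/
def allElems (k d : ℕ) (x e : Term) : Term :=
  not (anyArc k (and (elem d (var k) x) (not e)))

/-- The mixed difference, along the deviation of at most `f` arcs to `w` with the code `y`, of the
indicator that a walk to `w`, together with the arcs `var k` that satisfy `e`, contains the set of
at most `d` arcs with the code `x`. -/
def mixedDiff (k d : ℕ) (x : Term) : ℕ → Term → Term → Term → Term
  | 0, _, w, e => indicator (allElems k d x (or (onCanonPath (k + 1) source w (var k)) e))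
  | f + 1, y, w, e => ite y
      (op .sub
        (mixedDiff k d x f (fst y) (tailOf (headArc y)) (or (op .eq (var k) (headArc y))
          (or (onCanonPath (k + 1) (headOf (headArc y)) w (var k)) e)))
        (mixedDiff k d x f (fst y) (tailOf (headArc y))
          (or (onCanonPath (k + 1) (tailOf (headArc y)) w (var k)) e)))
      (indicator (allElems k d x (or (onCanonPath (k + 1) source w (var k)) e)))

variable {n m : ℕ} {G : ArcDigraph n m} {s t w : Fin n} {R k d f : ℕ} {T : ℕ → ℤ → ℤ} {ρ : ℕ → ℤ}
  {x y z e : Term} {D L Q : List (Fin m)} {B : Finset (Fin m)} {b : Fin m}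

theorem Decides.allElems {P : Fin m → Prop} (hx : Denotes R T k ρ x (listCode (n + m + 2) L))
    (h : HasPairs R G s t T) (hlt : listCode (n + m + 2) L < R) (hL : L.length ≤ d)
    (he : ∀ b : Fin m, Decides R T (k + 1) (Function.update ρ k (b : ℕ)) e (P b)) :
    Decides R T k ρ (allElems k d x e) (∀ b ∈ L, P b) :=
  (Decides.anyArc h fun b => (Decides.elem denotes_var_update hx.push h hlt hL).and fun _ =>
    (he b).not).not.congr (by simp only [not_exists, not_and, not_not])

theorem Denotes.indicator_allElems (hx : Denotes R T k ρ x (setCode (n + m + 2) B))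
    (h : HasPairs R G s t T) (hlt : setCode (n + m + 2) B < R) (hB : B.card ≤ d)
    (he : ∀ b : Fin m, Decides R T (k + 1) (Function.update ρ k (b : ℕ)) e (b ∈ Q)) :
    Denotes R T k ρ (Term.indicator (Term.allElems k d x e)) (subsetIndicator B Q) := by
  refine Decides.indicator <| (Decides.allElems hx h hlt ?_ he).congr ?_
  · rwa [Finset.length_sort]
  · simp only [Finset.mem_sort, Finset.subset_iff, List.mem_toFinset]

theorem Decides.mem_canonPath_append {u : Fin n} (hG : G.Acyclic) (h : Prepared R G s t T)
    (hx : Denotes R T k ρ x (u : ℕ)) (hy : Denotes R T k ρ y (w : ℕ)) (huw : G.Reach u w)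
    (he : Decides R T (k + 1) (Function.update ρ k (b : ℕ)) e (b ∈ Q)) :
    Decides R T (k + 1) (Function.update ρ k (b : ℕ))
      (Term.or (Term.onCanonPath (k + 1) x y (var k)) e) (b ∈ G.canonPath u w ++ Q) :=
  ((Decides.onCanonPath hG h hx.push hy.push denotes_var_update huw).or he).congr
    List.mem_append.symm

theorem Denotes.mixedDiff (hG : G.Acyclic) (h : Prepared R G s t T)
    (hx : Denotes R T k ρ x (setCode (n + m + 2) B)) (hlt : setCode (n + m + 2) B < R)
    (hB : B.card ≤ d) (hD : G.IsDeviation s D w)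
    (hy : Denotes R T k ρ y (listCode (n + m + 2) D)) (hDlt : listCode (n + m + 2) D < R)
    (hDf : D.length ≤ f) (hz : Denotes R T k ρ z (w : ℕ))
    (he : ∀ b : Fin m, Decides R T (k + 1) (Function.update ρ k (b : ℕ)) e (b ∈ Q)) :
    Denotes R T k ρ (mixedDiff k d x f y z e)
      (G.mixedDiff s D w fun P => subsetIndicator B (P ++ Q)) := by
  have hin := h.toHasInput
  induction D generalizing f w y z e Q with
  | nil =>
    have hleaf := Denotes.indicator_allElems hx h.toHasPairs hlt hB fun b =>
      .mem_canonPath_append hG h (denotes_source hin) hz hD (he b)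
    cases f with
    | zero => exact hleaf
    | succ f => exact .ite_neg hy.isCons (not_not.2 rfl) hleaf
  | cons a D ih =>
    obtain ⟨f, rfl⟩ := Nat.exists_eq_add_of_le' ((Nat.le_add_left 1 _).trans hDf)
    obtain ⟨haw, -, hD⟩ := hD
    have ha := hy.headArc_of_cons h.toHasPairs hDlt
    have ih {e' Q'} := ih (e := e') (Q := Q') hD (hy.fst_of_cons h.toHasPairs hDlt)
      (listCode_lt_of_cons hDlt) (Nat.le_of_succ_le_succ hDf) (ha.tailOf hin)
    rw [mixedDiff_cons_subsetIndicator_append]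
    refine .ite_pos hy.isCons (List.cons_ne_nil a D) ((ih fun b => ?_).sub (ih fun b => ?_))
    · exact ((denotes_var_update.eq_fin ha.push).or
        (.mem_canonPath_append hG h (ha.headOf hin) hz haw (he b))).congr List.mem_cons.symm
    · exact .mem_canonPath_append hG h (ha.tailOf hin) hz haw.tail_of_head (he b)

end Term

end MixedDifferenceTerms

section ObstructionTerms

namespace Term

/-- The condition that `x` is the code of an obstruction; it binds the variable `k`. -/
def isObstruction (k d : ℕ) (x : Term) : Term := and (isDeviation k d x) (fst x)

/-- The entry of the obstruction matrix in the row with the code `x` and the column with the code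
`y`; it binds variables from `k` on. -/
def obstructionEntry (k d : ℕ) (x y : Term) : Term := mixedDiff k d y d x sink (const 0)

/-- The condition that `x` is the code of a set of at most `d` arcs that is not the set of arcs of
an obstruction; it binds variables from `k` on. -/
def isNonpivot (k d : ℕ) (x : Term) : Term :=
  and (isSet d x)
    (not (any k (and (isObstruction (k + 1) d (var k)) (sameElems (k + 1) d (var k) x))))

/-- The entry of `pivotProj` for the obstruction matrix in the row with the code `x` and the column
with the code `y`; it binds variables from `k` on. -/
def kernelEntry (k d : ℕ) (x y : Term) : Term :=
  op .sub (indicator (op .eq x y))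
    (sum k (ite (isObstruction (k + 1) d (var k))
      (ite (sameElems (k + 1) d (var k) x) (obstructionEntry (k + 1) d (var k) y) (const 0))
      (const 0)))

variable {n m d : ℕ} {G : ArcDigraph n m} {s t : Fin n} {R k j : ℕ} {T : ℕ → ℤ → ℤ} {ρ : ℕ → ℤ}
  {x y : Term} {D : G.Obstruction s t d} {B C : ArcSubset m d}

theorem Decides.isObstruction (hG : G.Acyclic) (h : HasReach R G s t T) (hx : Denotes R T k ρ x j)
    (hj : j < R) : Decides R T k ρ (isObstruction k d x)
      (∃ D : G.Obstruction s t d, listCode (n + m + 2) D.1 = j) := by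
  have hlong : Decides R T k ρ (Term.isObstruction k d x)
      (∃ D, (D.length ≤ d ∧ listCode (n + m + 2) D = j ∧ G.IsDeviation s D t) ∧ 2 ≤ D.length) := by
    refine (Decides.isDeviation hG h hx hj).exists_and
      (fun _ _ hD hD' => listCode_injective (by omega) (hD.2.1.trans hD'.2.1.symm)) ?_
    rintro D ⟨-, rfl, -⟩
    rcases D with _ | ⟨a, D⟩
    · exact (hx.fst h.toHasPairs hj).decides.congr (by simp [listCode])
    · refine (hx.fst_of_cons h.toHasPairs hj).isCons.congr ?_
      rw [← List.length_pos_iff_ne_nil, List.length_cons]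
      omega
  exact hlong.congr ⟨fun ⟨D, ⟨hd, hcode, hD⟩, hlen⟩ => ⟨⟨D, hD, hlen, hd⟩, hcode⟩,
    fun ⟨D, hcode⟩ => ⟨D.1, ⟨D.2.2.2, hcode, D.2.1⟩, D.2.2.1⟩⟩

theorem listCode_obstruction_lt (hR : (n + m + 2) ^ d ≤ R) (D : G.Obstruction s t d) :
    listCode (n + m + 2) D.1 < R :=
  (listCode_lt_pow (by omega) D.2.2.2).trans_le hR

theorem setCode_lt (hR : (n + m + 2) ^ d ≤ R) (B : ArcSubset m d) :
    setCode (n + m + 2) B.1 < R :=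
  (setCode_lt_pow (by omega) B).trans_le hR

theorem Denotes.obstructionEntry (hG : G.Acyclic) (h : Prepared R G s t T)
    (hR : (n + m + 2) ^ d ≤ R) (hx : Denotes R T k ρ x (listCode (n + m + 2) D.1))
    (hy : Denotes R T k ρ y (setCode (n + m + 2) B.1)) :
    Denotes R T k ρ (obstructionEntry k d x y) (G.obstructionMatrix s t d D B) := by
  have hdiff := Denotes.mixedDiff hG h hy (setCode_lt hR B) B.2 D.2.1 hx
    (listCode_obstruction_lt hR D) D.2.2.2 (denotes_sink h.toHasInput) (e := const 0) (Q := [])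
    fun b => (denotes_const 0).decides.congr (by simp)
  simp only [List.append_nil] at hdiff
  exact hdiff

theorem Decides.eq_pivot (h : HasPairs R G s t T) (hR : (n + m + 2) ^ d ≤ R)
    (hx : Denotes R T k ρ x (listCode (n + m + 2) D.1))
    (hy : Denotes R T k ρ y (setCode (n + m + 2) B.1)) :
    Decides R T k ρ (Term.sameElems k d x y) (B = G.pivot s t d D) := by
  refine (Decides.sameElems hx hy h (listCode_obstruction_lt hR D) (setCode_lt hR B) D.2.2.2
    ((Finset.length_sort _).trans_le B.2)).congr ?_
  simp [Subtype.ext_iff, Finset.ext_iff, pivot, iff_comm]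

theorem Decides.isNonpivot (hG : G.Acyclic) (h : HasReach R G s t T) (hR : (n + m + 2) ^ d ≤ R)
    (hx : Denotes R T k ρ x j) (hj : j < R) : Decides R T k ρ (isNonpivot k d x)
      (∃ C : {C // C ∉ Set.range (G.pivot s t d)},
        setCode (n + m + 2) C.1.1 = j) := by
  refine ((Decides.isSet h.toHasPairs hx hj).exists_and (Q := (· ∉ Set.range (G.pivot s t d)))
    (fun _ _ hB hB' => Subtype.ext (setCode_injective (by omega) (hB.trans hB'.symm))) ?_).congr
      ⟨fun ⟨C, hcode, hC⟩ => ⟨⟨C, hC⟩, hcode⟩, fun ⟨C, hcode⟩ => ⟨C.1, hcode, C.2⟩⟩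
  rintro C rfl
  exact (Decides.any_and ((listCode_injective (by omega)).comp Subtype.val_injective)
    (listCode_obstruction_lt hR) (fun _ => Decides.isObstruction hG h denotes_var_update)
    fun D => (Decides.eq_pivot h.toHasPairs hR denotes_var_update hx.push).congr eq_comm).not

theorem Denotes.kernelEntry (hG : G.Acyclic) (h : Prepared R G s t T) (hR : (n + m + 2) ^ d ≤ R)
    (hx : Denotes R T k ρ x (setCode (n + m + 2) B.1))
    (hy : Denotes R T k ρ y (setCode (n + m + 2) C.1)) :
    Denotes R T k ρ (kernelEntry k d x y)
      (pivotProj (G.obstructionMatrix s t d) (G.pivot s t d) B C) := by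
  have heq : Decides R T k ρ _ (B = C) := (hx.eq hy).congr <| Nat.cast_inj.trans <|
    (setCode_injective (by omega)).eq_iff.trans Subtype.val_inj
  rw [pivotProj_apply]
  refine heq.indicator.sub <| .sum_ite_const_zero
    ((listCode_injective (by omega)).comp Subtype.val_injective) (listCode_obstruction_lt hR)
    (fun j hj => .isObstruction hG h.toHasReach denotes_var_update hj) fun D => ?_
  have hD := Decides.eq_pivot h.toHasPairs hR denotes_var_update hx.push (D := D)
  split_ifs with hB
  · exact .ite_pos hD hB (.obstructionEntry hG h hR denotes_var_update hy.push)
  · exact .ite_neg hD hB (denotes_const 0)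

end Term

end ObstructionTerms

theorem Term.Decides.lists {β : Type*} {code : β → ℕ} {R k v : ℕ} {T : ℕ → ℤ → ℤ} {p : Term}
    {r : Fin k ≃ β} (hr : StrictMono (code ∘ r)) (hlt : ∀ b, code b < R)
    (hp : ∀ (ρ : ℕ → ℤ) (j : ℕ), j < R →
      Decides R T (v + 1) (Function.update ρ v j) p (∃ b, code b = j)) :
    Cmd.Lists R T v p (code ∘ r) := by
  refine Cmd.lists_of_strictMono hr fun ρ j => ⟨fun ⟨hj, h⟩ => ?_, ?_⟩
  · obtain ⟨b, hb⟩ := (hp ρ j hj _ fun _ _ => rfl).1 h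
    exact ⟨r.symm b, by rw [Function.comp_apply, r.apply_symm_apply, hb]⟩
  · rintro ⟨i, rfl⟩
    exact ⟨hlt (r i), (hp ρ _ (hlt (r i)) _ fun _ _ => rfl).2 ⟨r i, rfl⟩⟩

section Codes

variable {n m d R : ℕ} {G : ArcDigraph n m} {s t : Fin n}

theorem exists_strictMono_setCode {β : Type*} [Finite β] (hR : (n + m + 2) ^ d ≤ R)
    (ι : β ↪ ArcSubset m d) :
    ∃ k ≤ R, ∃ e : Fin k ≃ β, StrictMono fun i => setCode (n + m + 2) (ι (e i)).1 :=
  exists_equiv_strictMono (((setCode_injective (by omega)).comp Subtype.val_injective).comp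
    ι.injective) fun b => Term.setCode_lt hR (ι b)

theorem exists_strictMono_listCode (hR : (n + m + 2) ^ d ≤ R) :
    ∃ k ≤ R, ∃ f : Fin k ≃ G.Obstruction s t d,
      StrictMono fun i => listCode (n + m + 2) (f i).1 :=
  exists_equiv_strictMono ((listCode_injective (by omega)).comp Subtype.val_injective)
    (Term.listCode_obstruction_lt hR)

end Codes

namespace Cmd

/-- Outputs the characteristic vectors of the sets of at most `d` arcs. -/
def emitListing (d : ℕ) : Cmd :=
  emitMatrix (.isSet d (.var 0)) (.op .lt (.var 1) .arcs) (.indicator (.elem d (.var 1) (.var 0)))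

/-- Outputs the obstruction matrix. -/
def emitObstructions (d : ℕ) : Cmd :=
  emitMatrix (.isObstruction 1 d (.var 0)) (.isSet d (.var 1))
    (.obstructionEntry 2 d (.var 0) (.var 1))

/-- Outputs the basis of the kernel of the obstruction matrix from
`exists_basis_ker_mulVecLin`. -/
def emitKernelBasis (d : ℕ) : Cmd :=
  emitMatrix (.isNonpivot 1 d (.var 0)) (.isSet d (.var 1)) (.kernelEntry 2 d (.var 1) (.var 0))

/-- Computes the tables, then outputs the listing of `A^(d)`, the obstruction matrix and the kernel
basis. -/
def linearizability (d : ℕ) : Cmd :=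
  seq prepare (seq (seq (emitListing d) (emitObstructions d)) (emitKernelBasis d))

variable {n m d : ℕ} {G : ArcDigraph n m} {s t : Fin n} {R N k : ℕ} {T : ℕ → ℤ → ℤ} {ρ : ℕ → ℤ}
  {e : Fin N ≃ ArcSubset m d}

theorem lists_isSet {v : ℕ} (h : HasPairs R G s t T) (hR : (n + m + 2) ^ d ≤ R)
    (he : StrictMono fun i => setCode (n + m + 2) (e i).1) :
    Lists R T v (.isSet d (.var v)) fun i => setCode (n + m + 2) (e i).1 :=
  Term.Decides.lists (code := fun B : ArcSubset m d => setCode (n + m + 2) B.1) he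
    (Term.setCode_lt hR) fun _ _ => .isSet h Term.denotes_var_update

theorem outputs_emitListing (h : HasPairs R G s t T) (hR : (n + m + 2) ^ d ≤ R)
    (he : StrictMono fun i => setCode (n + m + 2) (e i).1) :
    Outputs R T ρ (emitListing d) (matrixWord (ArcSubset.listing e)) :=
  outputs_emitMatrix (lists_isSet h hR he)
    (Term.Decides.lists (r := Equiv.refl (Fin m)) Fin.val_strictMono h.arc_lt
      fun _ _ _ => Term.denotes_var_update.lt_arcs h.toHasInput) fun i _ =>
    ((Term.Decides.elem Term.denotes_var_update (Term.denotes_var_update (k := 0)).push h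
      (Term.setCode_lt hR (e i)) ((Finset.length_sort _).trans_le (e i).2)).indicator _
        fun _ _ => rfl).trans (if_congr (Finset.mem_sort _) rfl rfl)

theorem outputs_emitObstructions (hG : G.Acyclic) (h : Prepared R G s t T)
    (hR : (n + m + 2) ^ d ≤ R) {f : Fin k ≃ G.Obstruction s t d}
    (hf : StrictMono fun i => listCode (n + m + 2) (f i).1)
    (he : StrictMono fun i => setCode (n + m + 2) (e i).1) :
    Outputs R T ρ (emitObstructions d)
      (matrixWord ((G.obstructionMatrix s t d).submatrix f e)) :=
  outputs_emitMatrix (Term.Decides.lists (r := f)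
      (code := fun D : G.Obstruction s t d => listCode (n + m + 2) D.1) hf
      (Term.listCode_obstruction_lt hR)
      fun _ _ => .isObstruction hG h.toHasReach Term.denotes_var_update)
    (lists_isSet h.toHasPairs hR he) fun _ _ =>
      Term.Denotes.obstructionEntry hG h hR (Term.denotes_var_update (k := 0)).push
        (Term.denotes_var_update (k := 1)) _ fun _ _ => rfl

theorem outputs_emitKernelBasis (hG : G.Acyclic) (h : Prepared R G s t T)
    (hR : (n + m + 2) ^ d ≤ R) {g : Fin k ≃ {C // C ∉ Set.range (G.pivot s t d)}}
    (hg : StrictMono fun i => setCode (n + m + 2) (g i).1.1)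
    (he : StrictMono fun i => setCode (n + m + 2) (e i).1) :
    Outputs R T ρ (emitKernelBasis d) (matrixWord
      ((pivotProj (G.obstructionMatrix s t d) (G.pivot s t d)).transpose.submatrix
        (fun i => (g i).1) e)) :=
  outputs_emitMatrix (Term.Decides.lists (r := g)
      (code := fun C : {C // C ∉ Set.range (G.pivot s t d)} => setCode (n + m + 2) C.1.1) hg
      (fun C => Term.setCode_lt hR C.1)
      fun _ _ => .isNonpivot hG h.toHasReach hR Term.denotes_var_update)
    (lists_isSet h.toHasPairs hR he) fun _ _ =>
      Term.Denotes.kernelEntry hG h hR (Term.denotes_var_update (k := 1))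
        (Term.denotes_var_update (k := 0)).push _ fun _ _ => rfl

theorem out_run_linearizability (hG : G.Acyclic) (hR : (n + m + 2) ^ d ≤ R)
    (hR' : (n + m + 2) ^ 4 ≤ R) {f : Fin k ≃ G.Obstruction s t d}
    (hf : StrictMono fun i => listCode (n + m + 2) (f i).1)
    (he : StrictMono fun i => setCode (n + m + 2) (e i).1)
    {K : ℕ} {g : Fin K ≃ {C // C ∉ Set.range (G.pivot s t d)}}
    (hg : StrictMono fun i => setCode (n + m + 2) (g i).1.1) :
    ((linearizability d).run R ρ (initial (G.inputWord s t))).out =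
      matrixWord (ArcSubset.listing e) ++
        matrixWord ((G.obstructionMatrix s t d).submatrix f e) ++
        matrixWord ((pivotProj (G.obstructionMatrix s t d) (G.pivot s t d)).transpose.submatrix
          (fun i => (g i).1) e) := by
  obtain ⟨hout, h⟩ := prepared_run_prepare (ρ := ρ) hG (hasInput_initial G s t) hR'
  have hword := ((outputs_emitListing (ρ := ρ) h.toHasPairs hR he).seq
    (outputs_emitObstructions hG h hR hf he)).seq (outputs_emitKernelBasis hG h hR hg he)
  exact (congrArg State.out (hword _)).trans (congrArg (· ++ _) hout)

end Cmd

end RAM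

theorem mainTheorem3_general (d : ℕ) :
    ∃ (prog : RAM.Prog) (T : Polynomial ℕ),
      ∀ (n m : ℕ) (G : ArcDigraph n m) (s t : Fin n), s ≠ t → G.Acyclic →
        ∃ L : Submodule ℝ (OrderCost m d),
          (∀ q : OrderCost m d, q ∈ L ↔ G.Linearizable s t q) ∧
          ∃ (N k K : ℕ) (e : Fin N ≃ ArcSubset m d)
            (M : Matrix (Fin k) (ArcSubset m d) ℤ) (X : Matrix (Fin K) (ArcSubset m d) ℤ)
            (b : Module.Basis (Fin K) ℝ L) (steps : ℕ) (final : RAM.State),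
            LinearMap.ker (M.map (Int.cast : ℤ → ℝ)).mulVecLin = L ∧
            (∀ (j : Fin K) (B : ArcSubset m d), (b j : OrderCost m d) B = (X j B : ℝ)) ∧
            k ≤ T.eval (n + m) ∧ N ≤ T.eval (n + m) ∧
            RAM.Exec prog (RAM.initial (G.inputWord s t)) steps final ∧
            steps ≤ T.eval (n + m) ∧
            final.out = RAM.matrixWord (ArcSubset.listing e)
              ++ RAM.matrixWord (M.submatrix id e) ++ RAM.matrixWord (X.submatrix id e) := by
  obtain ⟨T, hT⟩ := (RAM.Cmd.linearizability d).exists_polynomial_exec_toProg (d + 4)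
  refine ⟨(RAM.Cmd.linearizability d).toProg (d + 4), T + (.X + 2) ^ (d + 4),
    fun n m G s t hst hG => ⟨_, hG.mem_ker_obstructionMatrix_iff hst, ?_⟩⟩
  have hd : (n + m + 2) ^ d ≤ (n + m + 2) ^ (d + 4) := Nat.pow_le_pow_right (by omega) (by omega)
  have h4 : (n + m + 2) ^ 4 ≤ (n + m + 2) ^ (d + 4) := Nat.pow_le_pow_right (by omega) (by omega)
  have hle : (n + m + 2) ^ (d + 4) ≤ (T + (.X + 2) ^ (d + 4)).eval (n + m) := by simp
  obtain ⟨N, hN, e, he⟩ := RAM.exists_strictMono_setCode hd (.refl (ArcSubset m d))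
  obtain ⟨k, hk, f, hf⟩ := RAM.exists_strictMono_listCode (G := G) (s := s) (t := t) hd
  obtain ⟨K, -, g, hg⟩ := RAM.exists_strictMono_setCode hd
    (.subtype (· ∉ Set.range (G.pivot s t d)))
  obtain ⟨b, hb⟩ := hG.exists_basis_ker_obstructionMatrix g
  have hker := ker_mulVecLin_submatrix ((G.obstructionMatrix s t d).map (Int.cast : ℤ → ℝ)) f
  obtain ⟨steps, final, hexec, hsteps, hout⟩ := hT n m (G.inputWord s t) rfl rfl
  exact ⟨N, k, K, e, (G.obstructionMatrix s t d).submatrix f id,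
    (pivotProj (G.obstructionMatrix s t d) (G.pivot s t d)).transpose.submatrix
      (fun j => (g j).1) id, b, steps, final, hker, hb,
    hk.trans hle, hN.trans hle, hexec, hsteps.trans (by simp),
    hout.trans (RAM.Cmd.out_run_linearizability hG hd h4 hf he hg)⟩

theorem mainTheorem3 (d : ℕ) :
    ∃ (prog : RAM.Prog) (T : Polynomial ℕ),
      ∀ (n m : ℕ) (G : ArcDigraph n m) (s t : Fin n),
        s ≠ t → G.Acyclic → G.PathCovered s t →
        -- the linearizable cost functions form a subspace `L`
        ∃ L : Submodule ℝ (OrderCost m d),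
          (∀ q : OrderCost m d, q ∈ L ↔ G.Linearizable s t q) ∧
          -- a matrix `M` with kernel `L`, the basis of `L` formed by the rows of `X`, and the
          -- order `e` in which the coordinates are listed in the output
          ∃ (N k K : ℕ) (e : Fin N ≃ ArcSubset m d)
            (M : Matrix (Fin k) (ArcSubset m d) ℤ) (X : Matrix (Fin K) (ArcSubset m d) ℤ)
            (b : Module.Basis (Fin K) ℝ L) (steps : ℕ) (final : RAM.State),
            LinearMap.ker (M.map (Int.cast : ℤ → ℝ)).mulVecLin = L ∧
            (∀ (j : Fin K) (B : ArcSubset m d), (b j : OrderCost m d) B = (X j B : ℝ)) ∧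
            k ≤ T.eval (n + m) ∧ N ≤ T.eval (n + m) ∧
            -- `prog` outputs the listing, `M` and the basis in polynomially many steps
            RAM.Exec prog (RAM.initial (G.inputWord s t)) steps final ∧
            steps ≤ T.eval (n + m) ∧
            final.out = RAM.matrixWord (ArcSubset.listing e)
              ++ RAM.matrixWord (M.submatrix id e) ++ RAM.matrixWord (X.submatrix id e) :=
  let ⟨prog, T, h⟩ := mainTheorem3_general d
  ⟨prog, T, fun n m G s t hst hG _ => h n m G s t hst hG⟩
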